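/- All curves are curves in the complex projective plane $\mathbb{P}^2$. Let $F: x^3+y^3+z^3=0$ be the Fermat cubic. A hyperosculating conic of $F$ is a conic that meets $F$ with intersection multiplicity at least $6$ at some point of $F$ which is neither a singular point nor an inflection point of $F$ (such a point is called sextactic). Let $\omega=e^{2\pi i/3}$ and let $p_1,\dots,p_9$ be the points $(1:\omega^k:0)$, $(0:1:\omega^k)$, $(\omega^k:0:1)$, $k=0,1,2$. Let $P_j$ be the set of all hyperosculating conics of $F$ that pass through $p_j$. **Theorem.** Let $j\in\{1,\dots,9\}$ and let $Q, Q', Q''$ be three distinct conics in $P_j$. Then $p_j$ is the only common point of $Q, Q', Q''$, and both the curve $Q\cup Q'\cup Q''$ and the curve $F\cup Q\cup Q'\cup Q''$ have at $p_j$ a singularity of Arnold's type $J_{2,0}$, i.e. the germ of the curve at $p_j$ is analytically equivalent to the germ at the origin of $u^3+b\,u^2v^2+v^6=0$ for some $b\in\mathbb{C}$ with $4b^3+27\neq 0$. Moreover, the curve $F\cup Q\cup Q'\cup Q''$, given by the product $f$ of the four equations, is reduced of degree $9$ and is free with exponents $(3,5)$: the module $$AR(f)=\{(a,b,c)\in\mathbb{C}[x,y,z]^3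 : a f_x+b f_y+c f_z=0\}$$ of Jacobian syzygies is minimally generated by two homogeneous syzygies, of degrees $3$ and $5$. -/

import Mathlib

/-! Plane projective curves are given by homogeneous polynomials in three variables over `ℂ`, and
points of the projective plane by non-zero vectors of homogeneous coordinates. -/

open MvPolynomial

noncomputable section

/-- The local equation at the point `p` of the curve `f = 0`, in the affine chart `x_i = p_i`
(where `p_i ≠ 0` is intended), with affine coordinates centred at `p`: the variable `x_i` is
replaced by the constant `p_i`, and each of the two other variables `x_j` by `p_j + u`, where `u`
is the corresponding affine coordinate. -/
def localEq (p : Fin 3 → ℂ) (i : Fin 3) (f : MvPolynomial (Fin 3) ℂ) : MvPolynomial (Fin 2) ℂ :=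
  aeval (i.insertNth (C (p i)) (fun k : Fin 2 => C (p (i.succAbove k)) + X k) :
    Fin 3 → MvPolynomial (Fin 2) ℂ) f

/-- A chart containing the point with homogeneous coordinates `p ≠ 0`: the first `i` for which
`p i ≠ 0`. -/
def chartIndex (p : Fin 3 → ℂ) : Fin 3 :=
  open Classical in if p 0 ≠ 0 then 0 else if p 1 ≠ 0 then 1 else 2

/-- The maximal ideal of the origin in `ℂ[u, v]`. -/
abbrev originIdeal : Ideal (MvPolynomial (Fin 2) ℂ) :=
  RingHom.ker (constantCoeff : MvPolynomial (Fin 2) ℂ →+* ℂ)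

instance originIdeal_isPrime : originIdeal.IsPrime := RingHom.ker_isPrime _

/-- The local ring of the affine plane at the origin. -/
abbrev LocalRingAtOrigin : Type := Localization.AtPrime originIdeal

/-- The intersection multiplicity `(f, g)_p` of two plane projective curves at `p ≠ 0`: the length
(equivalently, the complex dimension) of the quotient of the local ring of the plane at `p` by the
local equations of the two curves. It is `⊤` if they share a component through `p`. -/
def intersectionMult (f g : MvPolynomial (Fin 3) ℂ) (p : Fin 3 → ℂ) : ℕ∞ :=
  Module.length LocalRingAtOrigin
    (LocalRingAtOrigin ⧸ Ideal.span
      {algebraMap (MvPolynomial (Fin 2) ℂ) LocalRingAtOrigin (localEq p (chartIndex p) f),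
       algebraMap (MvPolynomial (Fin 2) ℂ) LocalRingAtOrigin (localEq p (chartIndex p) g)})

/-- `p` is a smooth point of the curve `f = 0`. -/
structure IsSmoothPoint (f : MvPolynomial (Fin 3) ℂ) (p : Fin 3 → ℂ) : Prop where
  ne_zero : p ≠ 0
  mem : eval p f = 0
  smooth : ∃ i, eval p (pderiv i f) ≠ 0

/-- The linear form defining the tangent line to `f = 0` at a smooth point `p`. -/
def tangentLine (f : MvPolynomial (Fin 3) ℂ) (p : Fin 3 → ℂ) : MvPolynomial (Fin 3) ℂ :=
  ∑ i, C (eval p (pderiv i f)) * X i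

/-- The smooth point `p` of `f = 0` is an inflection point: the tangent line at `p` meets the curve
there with multiplicity at least `3`. -/
def IsInflectionPoint (f : MvPolynomial (Fin 3) ℂ) (p : Fin 3 → ℂ) : Prop :=
  IsSmoothPoint f p ∧ 3 ≤ intersectionMult f (tangentLine f p) p

/-- `q = 0` is a hyperosculating conic of the curve `f = 0`: a conic that meets the curve with
multiplicity at least `6` at some point (a sextactic point) that is neither singular nor an
inflection point of the curve. -/
def IsHyperosculatingConic (f q : MvPolynomial (Fin 3) ℂ) : Prop :=
  q ≠ 0 ∧ q.IsHomogeneous 2 ∧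
    ∃ p, IsSmoothPoint f p ∧ ¬ IsInflectionPoint f p ∧ 6 ≤ intersectionMult f q p

/-- The Fermat cubic `x³ + y³ + z³`. -/
def fermatCubic : MvPolynomial (Fin 3) ℂ := X 0 ^ 3 + X 1 ^ 3 + X 2 ^ 3

/-- The nine points `(1 : ω^k : 0)`, `(0 : 1 : ω^k)`, `(ω^k : 0 : 1)`, for `k = 0, 1, 2` and
`ω = exp(2πi/3)`: the coordinate with index `j` is `0`, the cyclically next one is `1`, and the
remaining one is `ω^k`. -/
def basePoint (j k : Fin 3) : Fin 3 → ℂ := fun i =>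
  if i = j then 0
  else if i = j + 1 then 1
  else Complex.exp (2 * Real.pi * Complex.I / 3) ^ (k : ℕ)

/-- The nine classes of hyperosculating conics of the Fermat cubic: each consists of the
hyperosculating conics that pass through one of the nine points `basePoint j k`. (A conic is given
by its equation, so it occurs with all its non-zero multiples.) -/
def conicClass (j k : Fin 3) : Set (MvPolynomial (Fin 3) ℂ) :=
  {q | IsHyperosculatingConic fermatCubic q ∧ eval (basePoint j k) q = 0}

/-- The module `AR(f)` of Jacobian syzygies: the triples `(a, b, c)` of polynomials with
`a f_x + b f_y + c f_z = 0`. -/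
def jacobianSyzygies (f : MvPolynomial (Fin 3) ℂ) :
    Submodule (MvPolynomial (Fin 3) ℂ) (Fin 3 → MvPolynomial (Fin 3) ℂ) where
  carrier := {a | ∑ i, a i * pderiv i f = 0}
  zero_mem' := by simp
  add_mem' := by
    intro a b ha hb
    simp only [Set.mem_ofPred_eq, Pi.add_apply, add_mul, Finset.sum_add_distrib] at *
    rw [ha, hb, add_zero]
  smul_mem' := by
    intro c a ha
    simp only [Set.mem_ofPred_eq, Pi.smul_apply, smul_eq_mul, mul_assoc] at *
    rw [← Finset.mul_sum, ha, mul_zero]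

/-- `f = 0` is an `m`-syzygy curve with exponents `d_1 ≤ … ≤ d_m`: the module `AR(f)` is minimally
generated by `m` homogeneous syzygies of degrees `1 ≤ d_1 ≤ … ≤ d_m`. -/
def IsSyzygyCurve (f : MvPolynomial (Fin 3) ℂ) {m : ℕ} (d : Fin m → ℕ) : Prop :=
  Monotone d ∧ (∀ l, 1 ≤ d l) ∧
    ∃ r : Fin m → Fin 3 → MvPolynomial (Fin 3) ℂ,
      (∀ l i, (r l i).IsHomogeneous (d l)) ∧
      Submodule.span (MvPolynomial (Fin 3) ℂ) (Set.range r) = jacobianSyzygies f ∧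
      ∀ l, r l ∉ Submodule.span (MvPolynomial (Fin 3) ℂ) (r '' {l}ᶜ)

/-- The curve `f = 0` is reduced and free with exponents `(d₁, d₂)`, that is, it is a `2`-syzygy
curve with these exponents. -/
def IsFreeCurve (f : MvPolynomial (Fin 3) ℂ) (d₁ d₂ : ℕ) : Prop :=
  Squarefree f ∧ IsSyzygyCurve f ![d₁, d₂]

/-- Two germs of functions at the origin of `ℂ²` define analytically equivalent germs of curves:
they agree up to a local analytic change of coordinates and an analytic unit. -/
def GermEquiv (f g : (Fin 2 → ℂ) → ℂ) : Prop :=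
  ∃ (Φ : (Fin 2 → ℂ) → (Fin 2 → ℂ)) (U : (Fin 2 → ℂ) → ℂ),
    AnalyticAt ℂ Φ 0 ∧ Φ 0 = 0 ∧ Function.Bijective (fderiv ℂ Φ 0) ∧
    AnalyticAt ℂ U 0 ∧ U 0 ≠ 0 ∧
    ∀ᶠ w in nhds 0, f w = U w * g (Φ w)

/-- The curve `f = 0` has a singularity of Arnold's type `J_{2,0}` at the point `p ≠ 0`: its germ at
`p` is equivalent to `u³ + b u² v² + v⁶ = 0` for some `b` with `4 b³ + 27 ≠ 0`. -/
def HasJ20Singularity (f : MvPolynomial (Fin 3) ℂ) (p : Fin 3 → ℂ) : Prop :=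
  ∃ b : ℂ, 4 * b ^ 3 + 27 ≠ 0 ∧
    GermEquiv (fun w => eval w (localEq p (chartIndex p) f))
      (fun w => w 0 ^ 3 + b * w 0 ^ 2 * w 1 ^ 2 + w 1 ^ 6)

end

/-! Write x = x_{j+1}, y = ε x_{j+2}, z = x_j with ε³ = 1, and s = x + y, d = x - y; then F = x³ +
y³ + z³.

At a point of F with a zero coordinate the tangent line has contact 3, so a sextactic point p has
only nonzero coordinates. Contact at least 6 forces the equation of the conic to vanish to order 6
along a truncated parametrization of F at p (`X_pow_six_dvd_aeval_localEq`). After p is rescaled to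
(1:1:1), this is a system of six linear equations in the six coefficients. With r = p_1³/p_2³ it has
a nonzero solution only for r = 1, -2, -1/2 (`quadratic_coeffs_of_sextactic`), that is, when two
coordinates of p have equal cubes. The solutions are the multiples of d² + 2ρzs - 4ρ²z² with 2ρ³ =
-1. The only base point on such a conic is d = z = 0 (`exists_eq_of_mem_conicClass`).

Three distinct conics of a class thus belong to the three cube roots ρ of -1/2, and their product
is, up to a constant, the norm G = d⁶ - 16 z³ F. Since F is nonzero at the base point, u = (-16
F)^{1/3} z and v = d are local coordinates there, in which G is u³ + v⁶: type J_{2,0} with b = 0.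
The factor F is a unit and does not change the type.

Freeness of f = FG is Saito's criterion. Two explicit syzygies of degrees 3 and 5 have cross product
8∇f, so their determinant with the Euler field is 72 f. Cramer's rule writes any other syzygy
through these two with denominator f, and the denominator cancels because f and its partial
derivatives have no common factor (`not_dvd_partials`). The same fact makes f squarefree. -/

noncomputable section

/-! ### Colength of ideals with two generators in a local ring -/

section Length

variable {R : Type*} [CommRing R]

/-- Multiplication by x maps R/K to R/I, and its cokernel R/(I + (x)) is a quotient of R/J. -/
lemma Ideal.length_quotient_le_add {I J K : Ideal R} {x : R} (hJ : J ≤ I ⊔ Ideal.span {x})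
    (hK : ∀ y ∈ K, y * x ∈ I) :
    Module.length R (R ⧸ I) ≤ Module.length R (R ⧸ K) + Module.length R (R ⧸ J) := by
  let e : (R ⧸ K) →ₗ[R] R ⧸ I := Submodule.liftQ K
    ((Submodule.mkQ I).comp (LinearMap.toSpanSingleton R R x)) (by
      intro y hy
      simpa [LinearMap.mem_ker, Submodule.Quotient.mk_eq_zero] using
        (Ideal.Quotient.eq_zero_iff_mem.mpr (hK y hy) : Ideal.Quotient.mk I (y * x) = 0))
  rw [Module.length_eq_add_of_exact (LinearMap.range e).subtype (LinearMap.range e).mkQ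
    (Submodule.subtype_injective _) (Submodule.mkQ_surjective _) (LinearMap.exact_subtype_mkQ _)]
  refine add_le_add (Module.length_le_of_surjective e.rangeRestrict e.surjective_rangeRestrict) ?_
  have hker : J ≤ LinearMap.ker ((LinearMap.range e).mkQ.comp (Submodule.mkQ I)) := by
    intro y hy
    obtain ⟨i, hi, z, hz, rfl⟩ := Submodule.mem_sup.mp (hJ hy)
    obtain ⟨c, rfl⟩ := Ideal.mem_span_singleton'.mp hz
    have hi0 : Submodule.mkQ I i = 0 := Ideal.Quotient.eq_zero_iff_mem.mpr hi
    have hc : Submodule.mkQ I (c * x) ∈ LinearMap.range e := ⟨Submodule.Quotient.mk c, rfl⟩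
    rw [LinearMap.mem_ker, LinearMap.comp_apply, map_add, hi0, zero_add]
    simpa using! hc
  refine Module.length_le_of_surjective (Submodule.liftQ J _ hker) fun y ↦ ?_
  obtain ⟨m, rfl⟩ := Submodule.mkQ_surjective _ y
  obtain ⟨r, rfl⟩ := Submodule.mkQ_surjective _ m
  exact ⟨Submodule.Quotient.mk r, rfl⟩

lemma Ideal.length_quotient_span_pair_pow_le [IsLocalRing R] {g v : R}
    (hm : IsLocalRing.maximalIdeal R ≤ Ideal.span {g, v}) (n : ℕ) :
    Module.length R (R ⧸ Ideal.span {g, v ^ n}) ≤ n := by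
  induction n with
  | zero =>
    have : Ideal.span {g, v ^ 0} = ⊤ := Ideal.eq_top_of_isUnit_mem _
      (Ideal.subset_span (by simp : v ^ 0 ∈ ({g, v ^ 0} : Set R))) (by simp)
    have : Subsingleton (R ⧸ Ideal.span {g, v ^ 0}) := Ideal.Quotient.subsingleton_iff.mpr this
    rw [Module.length_eq_zero]; simp
  | succ n ih =>
    have h := Ideal.length_quotient_le_add (I := Ideal.span {g, v ^ (n + 1)})
      (J := Ideal.span {g, v ^ n}) (K := IsLocalRing.maximalIdeal R) (x := v ^ n) ?_ ?_
    · have h1 : Module.length R (R ⧸ IsLocalRing.maximalIdeal R) = 1 :=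
        (Module.length_eq_one_iff).mpr
          (isSimpleModule_iff_isCoatom.mpr (IsLocalRing.maximalIdeal.isMaximal R).out)
      rw [h1] at h
      refine h.trans ?_
      push_cast
      rw [add_comm]
      gcongr
    · rw [Ideal.span_le]
      rintro y (rfl | rfl)
      · exact Ideal.mem_sup_left (Ideal.subset_span (by simp))
      · exact Ideal.mem_sup_right (Ideal.subset_span (by simp))
    · intro y hy
      obtain ⟨a, b, rfl⟩ := Ideal.mem_span_pair.mp (hm hy)
      exact Ideal.mem_span_pair.mpr ⟨a * v ^ n, b, by ring⟩

/-- Induction on the exponent: let q = a g + b v^k. If b were a unit, then (g, q) = (g, v^k) would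
have colength at most k < n. So b lies in (g, v), which gives one more factor v. -/
lemma Ideal.mem_span_pair_pow_of_le_length [IsLocalRing R] {g v q : R}
    (hm : IsLocalRing.maximalIdeal R ≤ Ideal.span {g, v}) {n : ℕ}
    (h : (n : ℕ∞) ≤ Module.length R (R ⧸ Ideal.span {g, q})) :
    q ∈ Ideal.span {g, v ^ n} := by
  suffices H : ∀ k ≤ n, q ∈ Ideal.span {g, v ^ k} from H n le_rfl
  intro k
  induction k with
  | zero => exact fun _ ↦ Ideal.mem_span_pair.mpr ⟨0, q, by simp⟩
  | succ k ih =>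
    intro hk
    obtain ⟨a, b, hab⟩ := Ideal.mem_span_pair.mp (ih (by lia))
    by_cases hb : IsUnit b
    · exfalso
      obtain ⟨c, hc⟩ := hb.exists_left_inv
      have : Ideal.span {g, q} = Ideal.span {g, v ^ k} := by
        apply le_antisymm <;> rw [Ideal.span_le] <;> rintro y (rfl | rfl)
        · exact Ideal.subset_span (by simp)
        · exact Ideal.mem_span_pair.mpr ⟨a, b, hab⟩
        · exact Ideal.subset_span (by simp)
        · exact Ideal.mem_span_pair.mpr ⟨-c * a, c, by
            linear_combination (-c) * hab + v ^ k * hc⟩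
      rw [this] at h
      have := h.trans (Ideal.length_quotient_span_pair_pow_le hm k)
      norm_cast at this
      lia
    · obtain ⟨a', b', rfl⟩ := Ideal.mem_span_pair.mp (hm ((IsLocalRing.mem_maximalIdeal b).mpr hb))
      exact Ideal.mem_span_pair.mpr ⟨a + a' * v ^ k, b', by rw [← hab]; ring⟩

lemma Ideal.length_quotient_add_one_le {I J : Ideal R} (h : I < J) :
    Module.length R (R ⧸ J) + 1 ≤ Module.length R (R ⧸ I) := by
  have hs : Function.Surjective (Submodule.factor h.le) := Submodule.factor_surjective h.le
  rw [Module.length_eq_add_of_exact (LinearMap.ker (Submodule.factor h.le)).subtype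
    (Submodule.factor h.le) (Submodule.subtype_injective _) hs
    (LinearMap.exact_subtype_ker_map _), add_comm]
  gcongr
  rw [Order.one_le_iff_pos, Module.length_pos_iff, Submodule.nontrivial_iff_ne_bot]
  intro hb
  obtain ⟨x, hxJ, hxI⟩ := SetLike.exists_of_lt h
  have : Submodule.Quotient.mk x ∈ LinearMap.ker (Submodule.factor h.le) := by
    rw [LinearMap.mem_ker]
    change Submodule.Quotient.mk x = 0
    rwa [Submodule.Quotient.mk_eq_zero]
  rw [hb, Submodule.mem_bot, Submodule.Quotient.mk_eq_zero] at this
  exact hxI this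

-- The preimages of the ideals (X^n) form a strictly decreasing chain, because x^n separates the
-- n-th from the next.
open PowerSeries in
lemma Ideal.le_length_quotient_of_le_comap {k : Type*} [Field k] (φ : R →+* PowerSeries k) {x : R}
    (hx : φ x = PowerSeries.X) {J : Ideal R} {n : ℕ}
    (h : J ≤ (Ideal.span {(PowerSeries.X : PowerSeries k) ^ n}).comap φ) :
    (n : ℕ∞) ≤ Module.length R (R ⧸ J) := by
  refine le_trans ?_ (Module.length_le_of_surjective _ (Submodule.factor_surjective h))
  clear h
  induction n with
  | zero => simp
  | succ n ih =>
    push_cast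
    refine (add_le_add_left ih 1).trans (Ideal.length_quotient_add_one_le ?_)
    rw [SetLike.lt_iff_le_and_exists]
    refine ⟨Ideal.comap_mono (Ideal.span_singleton_le_span_singleton.mpr
      (pow_dvd_pow _ n.le_succ)), x ^ n, ?_, ?_⟩
    · rw [Ideal.mem_comap, map_pow, hx]
      exact Ideal.subset_span rfl
    · rw [Ideal.mem_comap, map_pow, hx, Ideal.mem_span_singleton]
      intro hd
      rw [pow_dvd_pow_iff PowerSeries.X_ne_zero PowerSeries.X_irreducible.not_isUnit] at hd
      lia

end Length

/-! ### Power series arcs through the origin and local equations -/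

/-- Substituting series without constant term preserves the value at the origin, so a polynomial
nonzero there becomes a unit and the substitution extends to the local ring. -/
lemma exists_localRingAtOrigin_hom {U V : PowerSeries ℂ} (hU : PowerSeries.constantCoeff U = 0)
    (hV : PowerSeries.constantCoeff V = 0) :
    ∃ φ : LocalRingAtOrigin →+* PowerSeries ℂ,
      ∀ f : MvPolynomial (Fin 2) ℂ, φ (algebraMap _ _ f) = aeval ![U, V] f := by
  have h : ∀ f : MvPolynomial (Fin 2) ℂ,
      PowerSeries.constantCoeff (aeval ![U, V] f) = constantCoeff f := by
    intro f
    have : (PowerSeries.constantCoeff (R := ℂ)).comp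
        (aeval (R := ℂ) ![U, V] : MvPolynomial (Fin 2) ℂ →ₐ[ℂ] PowerSeries ℂ).toRingHom =
        constantCoeff := by
      apply MvPolynomial.ringHom_ext
      · intro r
        simp
      · intro i
        fin_cases i <;> simp [hU, hV]
    exact congrArg (fun ψ : MvPolynomial (Fin 2) ℂ →+* ℂ => ψ f) this
  refine ⟨IsLocalization.lift (M := originIdeal.primeCompl)
    (g := (aeval (R := ℂ) ![U, V] : MvPolynomial (Fin 2) ℂ →ₐ[ℂ] PowerSeries ℂ).toRingHom) ?_, ?_⟩
  · rintro ⟨s, hs⟩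
    rw [PowerSeries.isUnit_iff_constantCoeff]
    change IsUnit (PowerSeries.constantCoeff (aeval ![U, V] s))
    rw [h, isUnit_iff_ne_zero]
    exact hs
  · intro f
    exact IsLocalization.lift_eq _ f

lemma maximalIdeal_localRingAtOrigin :
    IsLocalRing.maximalIdeal LocalRingAtOrigin =
      Ideal.span {algebraMap (MvPolynomial (Fin 2) ℂ) LocalRingAtOrigin (X 0),
        algebraMap (MvPolynomial (Fin 2) ℂ) LocalRingAtOrigin (X 1)} := by
  have h : originIdeal = Ideal.span {(X 0 : MvPolynomial (Fin 2) ℂ), X 1} := by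
    have hX : ({X 0, X 1} : Set (MvPolynomial (Fin 2) ℂ)) = X '' Set.univ := by
      ext f
      simp [Fin.exists_fin_two, eq_comm]
    ext f
    rw [hX, mem_ideal_span_X_image, RingHom.mem_ker]
    constructor
    · intro h m hm
      by_contra! h0
      have : m = 0 := by
        ext i
        exact h0 i trivial
      rw [mem_support_iff, this] at hm
      exact hm h
    · intro h
      by_contra h0
      obtain ⟨i, -, hi⟩ := h 0 (mem_support_iff.mpr h0)
      exact hi rfl
  rw [← Localization.AtPrime.map_eq_maximalIdeal]
  trans Ideal.map (algebraMap (MvPolynomial (Fin 2) ℂ) LocalRingAtOrigin)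
    (Ideal.span {(X 0 : MvPolynomial (Fin 2) ℂ), X 1})
  · exact congrArg _ h
  · rw [Ideal.map_span, Set.image_pair]

lemma aeval_localEq_zero {S : Type*} [CommRing S] [Algebra ℂ S] (U V : S) (p : Fin 3 → ℂ)
    (f : MvPolynomial (Fin 3) ℂ) :
    aeval ![U, V] (localEq p 0 f) = aeval ![algebraMap ℂ S (p 0), algebraMap ℂ S (p 1) + U,
      algebraMap ℂ S (p 2) + V] f := by
  rw [localEq, ← AlgHom.comp_apply, comp_aeval]
  congr 2
  funext i
  fin_cases i
  · simp
  · change aeval ![U, V] (C (p 1) + X 0) = _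
    simp
  · change aeval ![U, V] (C (p 2) + X 1) = _
    simp

lemma aeval_localEq_one {S : Type*} [CommRing S] [Algebra ℂ S] (U V : S) (p : Fin 3 → ℂ)
    (f : MvPolynomial (Fin 3) ℂ) :
    aeval ![U, V] (localEq p 1 f) = aeval ![algebraMap ℂ S (p 0) + U, algebraMap ℂ S (p 1),
      algebraMap ℂ S (p 2) + V] f := by
  rw [localEq, ← AlgHom.comp_apply, comp_aeval]
  congr 2
  funext i
  fin_cases i
  · change aeval ![U, V] (C (p 0) + X 0) = _
    simp
  · change aeval ![U, V] (C (p 1)) = _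
    simp
  · change aeval ![U, V] (C (p 2) + X 1) = _
    simp

/-! ### Inflection points of the Fermat cubic -/

lemma pderiv_fermatCubic (i : Fin 3) : pderiv i fermatCubic = C 3 * X i ^ 2 := by
  have h : (3 : MvPolynomial (Fin 3) ℂ) = C 3 := (map_ofNat C 3).symm
  fin_cases i <;> simp [fermatCubic, pderiv_X, Derivation.leibniz_pow, h]

lemma le_length_quotient_span_pair {g l x : LocalRingAtOrigin}
    {φ : LocalRingAtOrigin →+* PowerSeries ℂ} (hx : φ x = PowerSeries.X) (n : ℕ)
    (hg : PowerSeries.X ^ n ∣ φ g) (hl : PowerSeries.X ^ n ∣ φ l) :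
    (n : ℕ∞) ≤ Module.length LocalRingAtOrigin (LocalRingAtOrigin ⧸ Ideal.span {g, l}) := by
  refine Ideal.le_length_quotient_of_le_comap φ hx ?_
  rw [Ideal.span_le]
  rintro y (rfl | rfl)
  · exact Ideal.mem_span_singleton.mpr hg
  · exact Ideal.mem_span_singleton.mpr hl

/-- When p_i = 0 the tangent line is parametrized by moving the i-th coordinate alone. Along it the
cubic restricts to t³ and the tangent form to 0. -/
lemma isInflectionPoint_fermatCubic_of_eq_zero {p : Fin 3 → ℂ} (hp : IsSmoothPoint fermatCubic p)
    {i : Fin 3} (hi : p i = 0) : IsInflectionPoint fermatCubic p := by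
  refine ⟨hp, ?_⟩
  have hF : p 0 ^ 3 + p 1 ^ 3 + p 2 ^ 3 = 0 := by simpa [fermatCubic] using hp.mem
  obtain ⟨φ, hφ⟩ := exists_localRingAtOrigin_hom (U := PowerSeries.X) (V := 0) (by simp) (by simp)
  obtain ⟨ψ, hψ⟩ := exists_localRingAtOrigin_hom (U := 0) (V := PowerSeries.X) (by simp) (by simp)
  have hφX := hφ (X 0)
  have hψX := hψ (X 1)
  simp only [aeval_X, Matrix.cons_val_zero, Matrix.cons_val_one] at hφX hψX
  have hC0 : (PowerSeries.C (p 0)) ^ 3 + (PowerSeries.C (p 1)) ^ 3 + (PowerSeries.C (p 2)) ^ 3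
      = 0 := by
    rw [← map_pow, ← map_pow, ← map_pow, ← map_add, ← map_add, hF, map_zero]
  rw [intersectionMult]
  by_cases h0 : p 0 = 0
  · have h1 : p 1 ≠ 0 := by
      intro h1
      apply hp.ne_zero
      have h2 : p 2 = 0 := by simpa [h0, h1] using hF
      funext j; fin_cases j <;> assumption
    have hc : chartIndex p = 1 := by simp [chartIndex, h0, h1]
    rw [hc]
    refine le_length_quotient_span_pair hφX 3 ?_ ?_
    · rw [hφ, aeval_localEq_one]
      refine ⟨1, ?_⟩
      simp [fermatCubic, h0] at hC0 ⊢
      linear_combination hC0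
    · rw [hφ, aeval_localEq_one]
      refine ⟨0, ?_⟩
      simp [tangentLine, Fin.sum_univ_three, pderiv_fermatCubic, h0] at hC0 ⊢
      linear_combination (PowerSeries.C 3) * hC0
  have hc : chartIndex p = 0 := by simp [chartIndex, h0]
  rw [hc]
  by_cases h1 : p 1 = 0
  · refine le_length_quotient_span_pair hφX 3 ?_ ?_
    · rw [hφ, aeval_localEq_zero]
      refine ⟨1, ?_⟩
      simp [fermatCubic, h1] at hC0 ⊢
      linear_combination hC0
    · rw [hφ, aeval_localEq_zero]
      refine ⟨0, ?_⟩
      simp [tangentLine, Fin.sum_univ_three, pderiv_fermatCubic, h1] at hC0 ⊢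
      linear_combination (PowerSeries.C 3) * hC0
  · have h2 : p 2 = 0 := by fin_cases i <;> simp_all
    refine le_length_quotient_span_pair hψX 3 ?_ ?_
    · rw [hψ, aeval_localEq_zero]
      refine ⟨1, ?_⟩
      simp [fermatCubic, h2] at hC0 ⊢
      linear_combination hC0
    · rw [hψ, aeval_localEq_zero]
      refine ⟨0, ?_⟩
      simp [tangentLine, Fin.sum_univ_three, pderiv_fermatCubic, h2] at hC0 ⊢
      linear_combination (PowerSeries.C 3) * hC0

/-! ### Classification of the hyperosculating conics -/

/-- Modulo the cubic, q is a multiple of the n-th power of the second local coordinate, and that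
coordinate vanishes at the start of the arc. Hence an arc with contact n with the cubic has contact
n with q. -/
lemma X_pow_six_dvd_aeval_localEq {p : Fin 3 → ℂ} (h0 : p 0 ≠ 0) (h1 : p 1 ≠ 0)
    (hF : p 0 ^ 3 + p 1 ^ 3 + p 2 ^ 3 = 0) {q : MvPolynomial (Fin 3) ℂ} {n : ℕ}
    (hq : (n : ℕ∞) ≤ intersectionMult fermatCubic q p)
    {U V : PowerSeries ℂ} (hU : PowerSeries.constantCoeff U = 0)
    (hV : PowerSeries.constantCoeff V = 0)
    (hUV : PowerSeries.X ^ n ∣ aeval ![U, V] (localEq p 0 fermatCubic)) :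
    PowerSeries.X ^ n ∣ aeval ![U, V] (localEq p 0 q) := by
  have hc : chartIndex p = 0 := by simp [chartIndex, h0]
  obtain ⟨φ, hφ⟩ := exists_localRingAtOrigin_hom hU hV
  rw [intersectionMult, hc] at hq
  set π := algebraMap (MvPolynomial (Fin 2) ℂ) LocalRingAtOrigin with hπ
  have hloc : localEq p 0 fermatCubic = X 0 * (C (3 * p 1 ^ 2) + C (3 * p 1) * X 0 + X 0 ^ 2) +
      X 1 * (C (3 * p 2 ^ 2) + C (3 * p 2) * X 1 + X 1 ^ 2) := by
    have := aeval_localEq_zero (X 0 : MvPolynomial (Fin 2) ℂ) (X 1) p fermatCubic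
    have hid : (![X 0, X 1] : Fin 2 → MvPolynomial (Fin 2) ℂ) = X := by
      funext j; fin_cases j <;> rfl
    rw [hid, aeval_X_left, AlgHom.id_apply] at this
    rw [this]
    have hC0 : (C (p 0) ^ 3 + C (p 1) ^ 3 + C (p 2) ^ 3 : MvPolynomial (Fin 2) ℂ) = 0 := by
      rw [← map_pow, ← map_pow, ← map_pow, ← map_add, ← map_add, hF, map_zero]
    simp [fermatCubic, MvPolynomial.algebraMap_eq]
    have h3 : (C 3 : MvPolynomial (Fin 2) ℂ) = 3 := map_ofNat C 3
    rw [h3]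
    linear_combination hC0
  have hm : IsLocalRing.maximalIdeal LocalRingAtOrigin ≤
      Ideal.span {π (localEq p 0 fermatCubic), π (X 1)} := by
    rw [maximalIdeal_localRingAtOrigin, Ideal.span_le]
    rintro y (rfl | rfl)
    -- Since p_1 ≠ 0, the cofactor of `X 0` in the cubic is a unit, so the cubic can replace `X 0`
    -- as a local coordinate.
    · have hu : IsUnit (π (C (3 * p 1 ^ 2) + C (3 * p 1) * X 0 + X 0 ^ 2)) :=
        IsLocalization.map_units LocalRingAtOrigin
          (⟨_, by
            change ¬ (_ ∈ originIdeal)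
            rw [RingHom.mem_ker]
            simpa using h1⟩ : originIdeal.primeCompl)
      obtain ⟨c, hcu⟩ := hu.exists_left_inv
      refine Ideal.mem_span_pair.mpr ⟨c, -c * π (C (3 * p 2 ^ 2) + C (3 * p 2) * X 1 + X 1 ^ 2), ?_⟩
      rw [hloc, map_add, map_mul π (X 0), map_mul π (X 1)]
      linear_combination π (X 0) * hcu
    · exact Ideal.subset_span (Set.mem_insert_of_mem _ rfl)
  obtain ⟨a, b, hab⟩ := Ideal.mem_span_pair.mp (Ideal.mem_span_pair_pow_of_le_length hm hq)
  rw [← hφ] at hUV ⊢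
  rw [← hab, map_add, map_mul, map_mul, map_pow]
  refine dvd_add (hUV.mul_left _) (Dvd.dvd.mul_left (pow_dvd_pow_of_dvd ?_ _) _)
  rw [hφ, aeval_X]
  exact PowerSeries.X_dvd_iff.mpr hV

lemma MvPolynomial.IsHomogeneous.exists_eq_ternary_quadratic {K : Type*} [CommRing K]
    {q : MvPolynomial (Fin 3) K} (hq : q.IsHomogeneous 2) :
    ∃ a₀ a₁ a₂ b₀ b₁ b₂ : K, q = C a₀ * X 0 ^ 2 + C a₁ * X 1 ^ 2 + C a₂ * X 2 ^ 2 +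
      C b₀ * (X 1 * X 2) + C b₁ * (X 0 * X 2) + C b₂ * (X 0 * X 1) := by
  rw [q.as_sum]
  refine Finset.sum_induction _ (fun q ↦ ∃ a₀ a₁ a₂ b₀ b₁ b₂ : K,
    q = C a₀ * X 0 ^ 2 + C a₁ * X 1 ^ 2 + C a₂ * X 2 ^ 2 +
      C b₀ * (X 1 * X 2) + C b₁ * (X 0 * X 2) + C b₂ * (X 0 * X 1)) ?_ ?_ ?_
  · rintro _ _ ⟨a₀, a₁, a₂, b₀, b₁, b₂, rfl⟩ ⟨c₀, c₁, c₂, d₀, d₁, d₂, rfl⟩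
    refine ⟨a₀ + c₀, a₁ + c₁, a₂ + c₂, b₀ + d₀, b₁ + d₁, b₂ + d₂, ?_⟩
    simp only [map_add]
    ring
  · exact ⟨0, 0, 0, 0, 0, 0, by simp⟩
  · intro d hd
    have hdeg := hq (mem_support_iff.mp hd)
    rw [Finsupp.weight_apply, Finsupp.sum_fintype _ _ (by simp)] at hdeg
    simp only [Pi.one_apply, smul_eq_mul, mul_one, Fin.sum_univ_three] at hdeg
    generalize coeff d q = c
    have hmon : monomial d c = C c * (X 0 ^ d 0 * X 1 ^ d 1 * X 2 ^ d 2) := by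
      rw [monomial_eq, Finsupp.prod_fintype _ _ (by simp), Fin.prod_univ_three]
    rw [hmon]
    have h0 : d 0 ≤ 2 := by lia
    have h1 : d 1 ≤ 2 := by lia
    have h2 : d 2 = 2 - d 0 - d 1 := by lia
    rw [h2]
    generalize d 0 = m at *
    generalize d 1 = n at *
    interval_cases m <;> interval_cases n <;> simp at h2 hdeg ⊢
    · exact ⟨0, 0, c, 0, 0, 0, by simp⟩
    · exact ⟨0, 0, 0, c, 0, 0, by simp⟩
    · exact ⟨0, c, 0, 0, 0, 0, by simp⟩
    · exact ⟨0, 0, 0, 0, c, 0, by simp⟩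
    · exact ⟨0, 0, 0, 0, 0, c, by simp⟩
    · lia
    · exact ⟨c, 0, 0, 0, 0, 0, by simp⟩
    all_goals lia

/-- The hyperosculating conic of the Fermat cubic at the point with
`x_{j+1} = ε x_{j+2} = ρ x_j`, where `ε³ = 1` and `2 ρ³ = -1`. -/
def osculatingConic (j : Fin 3) (ε ρ : ℂ) : MvPolynomial (Fin 3) ℂ :=
  (X (j + 1) - C ε * X (j + 2)) ^ 2 - C (4 * ρ ^ 2) * X j ^ 2 +
    C (2 * ρ) * X j * (X (j + 1) + C ε * X (j + 2))

lemma PowerSeries.coeffs_eq_zero_of_X_pow_six_dvd {K : Type*} [CommRing K]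
    {e₀ e₁ e₂ e₃ e₄ e₅ : K} {S : PowerSeries K}
    (h : (PowerSeries.X : PowerSeries K) ^ 6 ∣ PowerSeries.C e₀ + PowerSeries.C e₁ * PowerSeries.X +
      PowerSeries.C e₂ * PowerSeries.X ^ 2 + PowerSeries.C e₃ * PowerSeries.X ^ 3 +
      PowerSeries.C e₄ * PowerSeries.X ^ 4 + PowerSeries.C e₅ * PowerSeries.X ^ 5 +
      PowerSeries.X ^ 6 * S) :
    e₀ = 0 ∧ e₁ = 0 ∧ e₂ = 0 ∧ e₃ = 0 ∧ e₄ = 0 ∧ e₅ = 0 := by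
  rw [dvd_add_left (dvd_mul_right _ _), PowerSeries.X_pow_dvd_iff] at h
  have h0 := h 0 (by norm_num)
  have h1 := h 1 (by norm_num)
  have h2 := h 2 (by norm_num)
  have h3 := h 3 (by norm_num)
  have h4 := h 4 (by norm_num)
  have h5 := h 5 (by norm_num)
  simp [PowerSeries.coeff_X_pow, PowerSeries.coeff_C] at h0 h1 h2 h3 h4 h5
  exact ⟨h0, h1, h2, h3, h4, h5⟩

/-- A parametrization of the curve `ξ³ + r η³ = 1 + r`, truncated after order `5`, at the
point `(1, 1)`: it is `ξ = 1 + truncatedRoot r`, `η = 1 + 3 t`. -/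
def truncatedRoot (r : ℂ) : PowerSeries ℂ :=
  PowerSeries.C (-3 * r) * PowerSeries.X +
    PowerSeries.C (-9 * r ^ 2 - 9 * r) * PowerSeries.X ^ 2 +
    PowerSeries.C (-45 * r ^ 3 - 54 * r ^ 2 - 9 * r) * PowerSeries.X ^ 3 +
    PowerSeries.C (-270 * r ^ 4 - 405 * r ^ 3 - 135 * r ^ 2) * PowerSeries.X ^ 4 +
    PowerSeries.C (-1782 * r ^ 5 - 3240 * r ^ 4 - 1620 * r ^ 3 - 162 * r ^ 2) * PowerSeries.X ^ 5

/-- The 3 in η = 1 + 3t clears the denominators of the binomial series for the cube root, so all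
coefficients are integer polynomials in r. The witness is the exact quotient by X⁶. -/
lemma X_pow_six_dvd_truncatedRoot (r : ℂ) :
    (PowerSeries.X : PowerSeries ℂ) ^ 6 ∣
      PowerSeries.C r * ((1 + 3 * PowerSeries.X) ^ 3 - 1) + ((1 + truncatedRoot r) ^ 3 - 1) := by
  simp only [truncatedRoot, map_sub, map_mul, map_pow, map_neg, map_ofNat]
  generalize PowerSeries.C r = R
  generalize (PowerSeries.X : PowerSeries ℂ) = X
  refine ⟨
    ((37422 * R ^ 6 + 80190 * R ^ 5 + 53460 * R ^ 4 + 10935 * R ^ 3 + 243 * R ^ 2) + (48114 * R ^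
    7 + 192456 * R ^ 6 + 240570 * R ^ 5 + 109350 * R ^ 4 + 13122 * R ^ 3) * X + (72171 * R ^ 8 +
    288684 * R ^ 7 + 433026 * R ^ 6 + 295245 * R ^ 5 + 85293 * R ^ 4 + 6561 * R ^ 3) * X ^ 2 +
    (-392931 * R ^ 9 - 1154736 * R ^ 8 - 1202850 * R ^ 7 - 524880 * R ^ 6 - 96228 * R ^ 5 - 13122
    * R ^ 4 - 729 * R ^ 3) * X ^ 3 + (-7072758 * R ^ 10 - 25765047 * R ^ 9 - 36374184 * R ^ 8 -
    24820263 * R ^ 7 - 8247177 * R ^ 6 - 1141614 * R ^ 5 - 32805 * R ^ 4) * X ^ 4 + (-75228426 * R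
    ^ 11 - 303118200 * R ^ 10 - 486504711 * R ^ 9 - 393620634 * R ^ 8 - 166754376 * R ^ 7 -
    34484616 * R ^ 6 - 2775303 * R ^ 5 - 39366 * R ^ 4) * X ^ 5 + (-235329948 * R ^ 12 -
    1073038428 * R ^ 11 - 1994084730 * R ^ 10 - 1931433741 * R ^ 9 - 1032117471 * R ^ 8 -
    294949755 * R ^ 7 - 39779343 * R ^ 6 - 1889568 * R ^ 5) * X ^ 6 + (-818419140 * R ^ 13 -
    3951086688 * R ^ 12 - 7899693318 * R ^ 11 - 8428654260 * R ^ 10 - 5147537526 * R ^ 9 -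
    1788830406 * R ^ 8 - 329493420 * R ^ 7 - 27280638 * R ^ 6 - 708588 * R ^ 5) * X ^ 7 +
    (-2572174440 * R ^ 14 - 13211623260 * R ^ 13 - 28495866420 * R ^ 12 - 33417010080 * R ^ 11 -
    23022024120 * R ^ 10 - 9374619240 * R ^ 9 - 2147021640 * R ^ 8 - 244462860 * R ^ 7 - 10628820
    * R ^ 6) * X ^ 8 + (-5658783768 * R ^ 15 - 30866093280 * R ^ 14 - 71553216240 * R ^ 13 -
    91675698264 * R ^ 12 - 70660395360 * R ^ 11 - 33417010080 * R ^ 10 - 9493662024 * R ^ 9 -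
    1530550080 * R ^ 8 - 127545840 * R ^ 7 - 4251528 * R ^ 6) * X ^ 9), ?_⟩
  ring

/-- Since 1, η and η² have degree at most 2 in t, the equations of orders 3, 4, 5 involve only 2a₂ +
b₀ + b₁, b₀ and a₂. Outside three values of r they force these to vanish, and the lower orders then
kill the remaining coefficients. -/
lemma quadratic_coeffs_of_sextactic {r a₀ a₁ a₂ b₀ b₁ b₂ : ℂ} (hr : r ≠ 0) (hr' : r + 1 ≠ 0)
    (h : (PowerSeries.X : PowerSeries ℂ) ^ 6 ∣ PowerSeries.C a₀ +
      PowerSeries.C a₁ * (1 + 3 * PowerSeries.X) ^ 2 +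
      PowerSeries.C a₂ * (1 + truncatedRoot r) ^ 2 +
      PowerSeries.C b₀ * ((1 + 3 * PowerSeries.X) * (1 + truncatedRoot r)) +
      PowerSeries.C b₁ * (1 + truncatedRoot r) + PowerSeries.C b₂ * (1 + 3 * PowerSeries.X)) :
    (a₀ = 0 ∧ a₁ = 0 ∧ a₂ = 0 ∧ b₀ = 0 ∧ b₁ = 0 ∧ b₂ = 0) ∨
    (r = 1 ∧ a₀ = -4 * a₁ ∧ a₂ = a₁ ∧ b₀ = -2 * a₁ ∧ b₁ = 2 * a₁ ∧ b₂ = 2 * a₁) ∨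
    (r = -2 ∧ a₁ = -4 * a₂ ∧ a₀ = a₂ ∧ b₁ = -2 * a₂ ∧ b₂ = 2 * a₂ ∧ b₀ = 2 * a₂) ∨
    (r = -1 / 2 ∧ a₂ = -4 * a₀ ∧ a₁ = a₀ ∧ b₂ = -2 * a₀ ∧ b₀ = 2 * a₀ ∧ b₁ = 2 * a₀) := by
  obtain ⟨v₁, hv₁⟩ : ∃ v, v = -3 * r := ⟨_, rfl⟩
  obtain ⟨v₂, hv₂⟩ : ∃ v, v = -9 * r ^ 2 - 9 * r := ⟨_, rfl⟩
  obtain ⟨v₃, hv₃⟩ : ∃ v, v = -45 * r ^ 3 - 54 * r ^ 2 - 9 * r := ⟨_, rfl⟩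
  obtain ⟨v₄, hv₄⟩ : ∃ v, v = -270 * r ^ 4 - 405 * r ^ 3 - 135 * r ^ 2 := ⟨_, rfl⟩
  obtain ⟨v₅, hv₅⟩ : ∃ v, v = -1782 * r ^ 5 - 3240 * r ^ 4 - 1620 * r ^ 3 - 162 * r ^ 2 :=
    ⟨_, rfl⟩
  rw [truncatedRoot, ← hv₁, ← hv₂, ← hv₃, ← hv₄, ← hv₅] at h
  obtain ⟨e0, e1, e2, e3, e4, e5⟩ := PowerSeries.coeffs_eq_zero_of_X_pow_six_dvd
    (e₀ := a₀ + a₁ + a₂ + b₀ + b₁ + b₂)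
    (e₁ := 3 * (2 * a₁ + b₀ + b₂) + (2 * a₂ + b₀ + b₁) * v₁)
    (e₂ := 9 * a₁ + (2 * a₂ + b₀ + b₁) * v₂ + 3 * b₀ * v₁ + a₂ * v₁ ^ 2)
    (e₃ := (2 * a₂ + b₀ + b₁) * v₃ + 3 * b₀ * v₂ + a₂ * (2 * v₁ * v₂))
    (e₄ := (2 * a₂ + b₀ + b₁) * v₄ + 3 * b₀ * v₃ + a₂ * (2 * v₁ * v₃ + v₂ ^ 2))
    (e₅ := (2 * a₂ + b₀ + b₁) * v₅ + 3 * b₀ * v₄ + a₂ * (2 * v₁ * v₄ + 2 * v₂ * v₃))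
    (S := PowerSeries.C (3 * b₀ * v₅ + a₂ * (2 * v₁ * v₅ + 2 * v₂ * v₄ + v₃ ^ 2)) +
      PowerSeries.C (a₂ * (2 * v₂ * v₅ + 2 * v₃ * v₄)) * PowerSeries.X +
      PowerSeries.C (a₂ * (2 * v₃ * v₅ + v₄ ^ 2)) * PowerSeries.X ^ 2 +
      PowerSeries.C (a₂ * (2 * v₄ * v₅)) * PowerSeries.X ^ 3 +
      PowerSeries.C (a₂ * v₅ ^ 2) * PowerSeries.X ^ 4) (by
        refine h.trans (dvd_of_eq ?_)
        simp only [map_add, map_mul, map_pow, map_ofNat]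
        ring)
  by_cases hdet : (r - 1) * (r + 2) * (2 * r + 1) = 0
  · right
    rcases mul_eq_zero.mp hdet with hdet | hdet
    · rcases mul_eq_zero.mp hdet with hdet | hdet
      · left
        obtain rfl : r = 1 := by linear_combination hdet
        norm_num at hv₁ hv₂ hv₃ hv₄ hv₅
        subst hv₁ hv₂ hv₃ hv₄ hv₅
        refine ⟨rfl, ?_, ?_, ?_, ?_, ?_⟩ <;> grind
      · right; left
        obtain rfl : r = -2 := by linear_combination hdet
        norm_num at hv₁ hv₂ hv₃ hv₄ hv₅
        subst hv₁ hv₂ hv₃ hv₄ hv₅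
        refine ⟨rfl, ?_, ?_, ?_, ?_, ?_⟩ <;> grind
    · right; right
      obtain rfl : r = -1 / 2 := by linear_combination hdet / 2
      norm_num at hv₁ hv₂ hv₃ hv₄ hv₅
      subst hv₁ hv₂ hv₃ hv₄ hv₅
      refine ⟨rfl, ?_, ?_, ?_, ?_, ?_⟩ <;> grind
  · left
    subst hv₁ hv₂ hv₃ hv₄ hv₅
    -- The determinant of `e3`, `e4`, `e5` in the unknowns 2a₂ + b₀ + b₁, b₀, a₂. The multipliers in
    -- the combinations below are its cofactors.
    have hN : -19683 * r ^ 4 * (r + 1) ^ 4 * ((r - 1) * (r + 2) * (2 * r + 1)) ≠ 0 := by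
      simp only [ne_eq, mul_eq_zero, not_or] at hdet ⊢
      simp [hr, hr', hdet]
    have hc : 2 * a₂ + b₀ + b₁ = 0 := by
      refine (mul_eq_zero.mp ?_).resolve_left hN
      linear_combination
        (-43740 * r ^ 8 - 142155 * r ^ 7 - 168399 * r ^ 6 - 89667 * r ^ 5 - 24057 * r ^ 4 - 4374 *
        r ^ 3) * e3 + (21870 * r ^ 7 + 69984 * r ^ 6 + 78732 * r ^ 5 + 34992 * r ^ 4 + 4374 * r ^
        3) * e4 + (-2187 * r ^ 6 - 6561 * r ^ 5 - 6561 * r ^ 4 - 2187 * r ^ 3) * e5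
    have hb : b₀ = 0 := by
      refine (mul_eq_zero.mp ?_).resolve_left hN
      linear_combination
        (30618 * r ^ 9 + 118098 * r ^ 8 + 174960 * r ^ 7 + 118098 * r ^ 6 + 30618 * r ^ 5) * e3 +
        (-13122 * r ^ 8 - 49572 * r ^ 7 - 74358 * r ^ 6 - 53946 * r ^ 5 - 17496 * r ^ 4 - 1458 * r
        ^ 3) * e4 + (1215 * r ^ 7 + 4374 * r ^ 6 + 6318 * r ^ 5 + 4374 * r ^ 4 + 1215 * r ^ 3) *
        e5
    have ha : a₂ = 0 := by
      refine (mul_eq_zero.mp ?_).resolve_left hN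
      linear_combination
        (-21870 * r ^ 8 - 69984 * r ^ 7 - 80919 * r ^ 6 - 43740 * r ^ 5 - 15309 * r ^ 4 - 4374 * r
        ^ 3) * e3 + (11664 * r ^ 7 + 37179 * r ^ 6 + 40095 * r ^ 5 + 15309 * r ^ 4 + 729 * r ^ 3)
        * e4 + (-1215 * r ^ 6 - 3645 * r ^ 5 - 3402 * r ^ 4 - 729 * r ^ 3 + 243 * r ^ 2) * e5
    subst hb ha
    have hb1 : b₁ = 0 := by linear_combination hc
    subst hb1
    have ha1 : a₁ = 0 := by linear_combination e2 / 9
    subst ha1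
    have hb2 : b₂ = 0 := by linear_combination e1 / 3
    subst hb2
    exact ⟨by linear_combination e0, rfl, rfl, rfl, rfl, rfl⟩

/-- The hyperosculating conics of the Fermat cubic. -/
theorem IsHyperosculatingConic.exists_eq_osculatingConic {q : MvPolynomial (Fin 3) ℂ}
    (hq : IsHyperosculatingConic fermatCubic q) :
    ∃ (j : Fin 3) (ε ρ c : ℂ), ε ^ 3 = 1 ∧ 2 * ρ ^ 3 = -1 ∧ c ≠ 0 ∧
      q = C c * osculatingConic j ε ρ := by
  obtain ⟨hq0, hq2, p, hp, hinf, hmult⟩ := hq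
  have hne : ∀ i, p i ≠ 0 := fun i hi ↦ hinf (isInflectionPoint_fermatCubic_of_eq_zero hp hi)
  have h0 := hne 0
  have h1 := hne 1
  have h2 := hne 2
  have hF : p 0 ^ 3 + p 1 ^ 3 + p 2 ^ 3 = 0 := by simpa [fermatCubic] using hp.mem
  obtain ⟨r, hr⟩ : ∃ r, r = p 1 ^ 3 / p 2 ^ 3 := ⟨_, rfl⟩
  have hr1 : p 1 ^ 3 = r * p 2 ^ 3 := by rw [hr]; field_simp
  have hr0 : p 0 ^ 3 = -(r + 1) * p 2 ^ 3 := by linear_combination hF - hr1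
  have hW0 : PowerSeries.constantCoeff (truncatedRoot r) = 0 := by simp [truncatedRoot]
  have hdvd := X_pow_six_dvd_aeval_localEq h0 h1 hF hmult
    (U := PowerSeries.C (p 1) * (3 * PowerSeries.X))
    (V := PowerSeries.C (p 2) * truncatedRoot r) (by simp) (by simp [hW0]) (by
      rw [aeval_localEq_zero]
      refine (X_pow_six_dvd_truncatedRoot r).trans ⟨PowerSeries.C (p 2 ^ 3), ?_⟩
      have hr1' := congrArg (PowerSeries.C (R := ℂ)) hr1
      have hr0' := congrArg (PowerSeries.C (R := ℂ)) hr0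
      simp [fermatCubic] at hr0' hr1' ⊢
      linear_combination hr0' + (1 + 3 * PowerSeries.X) ^ 3 * hr1')
  obtain ⟨a₀, a₁, a₂, b₀, b₁, b₂, rfl⟩ := hq2.exists_eq_ternary_quadratic
  -- These are the coefficients of the conic in the coordinates x_i / p_i, where p is (1:1:1).
  have hcoef := quadratic_coeffs_of_sextactic (r := r) (a₀ := a₀ * p 0 ^ 2) (a₁ := a₁ * p 1 ^ 2)
    (a₂ := a₂ * p 2 ^ 2) (b₀ := b₀ * (p 1 * p 2)) (b₁ := b₁ * (p 0 * p 2))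
    (b₂ := b₂ * (p 0 * p 1)) (by rw [hr]; simp [h1, h2]) (by
      intro h
      rw [h] at hr0
      simp [h0] at hr0) (by
      rw [aeval_localEq_zero] at hdvd
      refine hdvd.trans (dvd_of_eq ?_)
      simp
      ring)
  rcases hcoef with ⟨ha0, ha1, ha2, hb0, hb1, hb2⟩ | H
  · simp only [mul_eq_zero, pow_eq_zero_iff, h0, h1, h2, or_false, ne_eq, OfNat.ofNat_ne_zero,
      not_false_eq_true] at ha0 ha1 ha2 hb0 hb1 hb2
    simp [ha0, ha1, ha2, hb0, hb1, hb2] at hq0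
  -- The values r = 1, -2, -1/2 say that p_1³ = p_2³, p_2³ = p_0³, p_0³ = p_1³ respectively; j is
  -- the remaining index, and ε, ρ are ratios of coordinates of p.
  have key : ∃ (j : Fin 3) (ε ρ c : ℂ), ε ^ 3 = 1 ∧ 2 * ρ ^ 3 = -1 ∧
      C a₀ * X 0 ^ 2 + C a₁ * X 1 ^ 2 + C a₂ * X 2 ^ 2 +
      C b₀ * (X 1 * X 2) + C b₁ * (X 0 * X 2) + C b₂ * (X 0 * X 1) =
      C c * osculatingConic j ε ρ := by
    rcases H with ⟨rfl, ha0, ha2, hb0, hb1, hb2⟩ | ⟨rfl, ha1, ha0, hb1, hb2, hb0⟩ |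
      ⟨rfl, ha2, ha1, hb2, hb0, hb1⟩
    · refine ⟨0, p 1 / p 2, p 1 / p 0, a₁, by field_simp; linear_combination hr1, by
        field_simp; linear_combination 2 * hr1 + hr0, ?_⟩
      rw [show a₀ = a₁ * (-4 * (p 1 / p 0) ^ 2) by field_simp; linear_combination ha0,
        show a₂ = a₁ * (p 1 / p 2) ^ 2 by field_simp; linear_combination ha2,
        show b₀ = a₁ * (-2 * (p 1 / p 2)) by
          field_simp; apply mul_right_cancel₀ h1; linear_combination hb0,
        show b₁ = a₁ * (2 * (p 1 / p 0) * (p 1 / p 2)) by field_simp; linear_combination hb1,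
        show b₂ = a₁ * (2 * (p 1 / p 0)) by
          field_simp; apply mul_right_cancel₀ h1; linear_combination hb2]
      generalize p 1 / p 2 = ε
      generalize p 1 / p 0 = ρ
      rw [osculatingConic, show (0 + 1 : Fin 3) = 1 from rfl, show (0 + 2 : Fin 3) = 2 from rfl]
      simp only [map_mul, map_pow, map_neg, map_ofNat]
      ring
    · refine ⟨1, p 2 / p 0, p 2 / p 1, a₂, by field_simp; linear_combination -hr0, by
        field_simp; linear_combination hr1, ?_⟩
      rw [show a₁ = a₂ * (-4 * (p 2 / p 1) ^ 2) by field_simp; linear_combination ha1,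
        show a₀ = a₂ * (p 2 / p 0) ^ 2 by field_simp; linear_combination ha0,
        show b₁ = a₂ * (-2 * (p 2 / p 0)) by
          field_simp; apply mul_right_cancel₀ h2; linear_combination hb1,
        show b₂ = a₂ * (2 * (p 2 / p 1) * (p 2 / p 0)) by field_simp; linear_combination hb2,
        show b₀ = a₂ * (2 * (p 2 / p 1)) by
          field_simp; apply mul_right_cancel₀ h2; linear_combination hb0]
      generalize p 2 / p 0 = ε
      generalize p 2 / p 1 = ρ
      rw [osculatingConic, show (1 + 1 : Fin 3) = 2 from rfl, show (1 + 2 : Fin 3) = 0 from rfl]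
      simp only [map_mul, map_pow, map_neg, map_ofNat]
      ring
    · refine ⟨2, p 0 / p 1, p 0 / p 2, a₀, by field_simp; linear_combination hr0 - hr1, by
        field_simp; linear_combination 2 * hr0, ?_⟩
      rw [show a₂ = a₀ * (-4 * (p 0 / p 2) ^ 2) by field_simp; linear_combination ha2,
        show a₁ = a₀ * (p 0 / p 1) ^ 2 by field_simp; linear_combination ha1,
        show b₂ = a₀ * (-2 * (p 0 / p 1)) by
          field_simp; apply mul_right_cancel₀ h0; linear_combination hb2,
        show b₀ = a₀ * (2 * (p 0 / p 2) * (p 0 / p 1)) by field_simp; linear_combination hb0,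
        show b₁ = a₀ * (2 * (p 0 / p 2)) by
          field_simp; apply mul_right_cancel₀ h0; linear_combination hb1]
      generalize p 0 / p 1 = ε
      generalize p 0 / p 2 = ρ
      rw [osculatingConic, show (2 + 1 : Fin 3) = 0 from rfl, show (2 + 2 : Fin 3) = 1 from rfl]
      simp only [map_mul, map_pow, map_neg, map_ofNat]
      ring
  obtain ⟨j, ε, ρ, c, hε, hρ, h⟩ := key
  refine ⟨j, ε, ρ, c, hε, hρ, ?_, h⟩
  rintro rfl
  exact hq0 (by rw [h]; simp)

/-! ### The three conics through a base point -/

/-- The primitive cube root of unity in `basePoint`. -/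
def cubeRoot (k : Fin 3) : ℂ := Complex.exp (2 * Real.pi * Complex.I / 3) ^ (k : ℕ)

lemma cubeRoot_pow_three (k : Fin 3) : cubeRoot k ^ 3 = 1 := by
  rw [cubeRoot, pow_right_comm, ← Complex.exp_nat_mul]
  have : ((3 : ℕ) : ℂ) * (2 * Real.pi * Complex.I / 3) = 2 * Real.pi * Complex.I := by
    push_cast; ring
  rw [this, Complex.exp_two_pi_mul_I, one_pow]

lemma cubeRoot_ne_zero (k : Fin 3) : cubeRoot k ≠ 0 := fun h ↦ by
  simpa [h] using cubeRoot_pow_three k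

lemma basePoint_self (j k : Fin 3) : basePoint j k j = 0 := by simp [basePoint]

lemma basePoint_add_one (j k : Fin 3) : basePoint j k (j + 1) = 1 := by simp [basePoint]

lemma basePoint_add_two (j k : Fin 3) : basePoint j k (j + 2) = cubeRoot k := by
  simp [basePoint, cubeRoot]

lemma eq_or_eq_add_of_fin_three (i j : Fin 3) : i = j ∨ i = j + 1 ∨ i = j + 2 := by
  revert i j; decide

lemma forall_fin_three_cyclic {P : Fin 3 → Prop} (j : Fin 3) (h0 : P j) (h1 : P (j + 1))
    (h2 : P (j + 2)) (i : Fin 3) : P i := by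
  rcases eq_or_eq_add_of_fin_three i j with rfl | rfl | rfl <;> assumption

lemma eval_osculatingConic (p : Fin 3 → ℂ) (j : Fin 3) (ε ρ : ℂ) :
    eval p (osculatingConic j ε ρ) = (p (j + 1) - ε * p (j + 2)) ^ 2 - 4 * ρ ^ 2 * p j ^ 2 +
      2 * ρ * p j * (p (j + 1) + ε * p (j + 2)) := by
  simp [osculatingConic]

theorem exists_eq_of_mem_conicClass {j k : Fin 3} {q : MvPolynomial (Fin 3) ℂ}
    (hq : q ∈ conicClass j k) :
    ∃ ρ c : ℂ, 2 * ρ ^ 3 = -1 ∧ c ≠ 0 ∧ q = C c * osculatingConic j (cubeRoot k)⁻¹ ρ := by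
  obtain ⟨hq, hp⟩ := hq
  obtain ⟨i, ε, ρ, c, hε, hρ, hc, rfl⟩ := hq.exists_eq_osculatingConic
  have hζ := cubeRoot_pow_three k
  -- This excludes conics with another distinguished coordinate. Multiplying the equation by 2ρ - w
  -- leaves 8ρ²w = -3, whereas (8ρ²w)³ = 512ρ⁶ = 128.
  have hno : ∀ w ρ : ℂ, w ^ 3 = 1 → 2 * ρ ^ 3 = -1 → w ^ 2 - 4 * ρ ^ 2 + 2 * ρ * w ≠ 0 := by
    intro w ρ hw hρ h
    have h1 : 8 * (ρ ^ 2 * w) = -3 := by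
      linear_combination (2 * ρ - w) * h + hw + 4 * hρ
    have h2 : (8 * (ρ ^ 2 * w)) ^ 3 = 128 := by
      linear_combination 512 * ρ ^ 6 * hw + 256 * ρ ^ 3 * hρ - 128 * hρ
    rw [h1] at h2
    norm_num at h2
  rw [map_mul, eval_C, mul_eq_zero, or_iff_right hc, eval_osculatingConic] at hp
  rcases eq_or_eq_add_of_fin_three i j with rfl | rfl | rfl
  · rw [basePoint_self, basePoint_add_one, basePoint_add_two] at hp
    have h1 : ε = (cubeRoot k)⁻¹ := by
      apply eq_inv_of_mul_eq_one_left
      have : (1 - ε * cubeRoot k) ^ 2 = 0 := by linear_combination hp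
      linear_combination -(pow_eq_zero_iff two_ne_zero).mp this
    exact ⟨ρ, c, hρ, hc, by rw [h1]⟩
  · exfalso
    rw [add_assoc, add_assoc, show (1 + 1 : Fin 3) = 2 from rfl, show (1 + 2 : Fin 3) = 0 from rfl,
      add_zero, basePoint_self, basePoint_add_one, basePoint_add_two] at hp
    exact hno _ ρ hζ hρ (by linear_combination hp)
  · exfalso
    rw [add_assoc, add_assoc, show (2 + 1 : Fin 3) = 0 from rfl, show (2 + 2 : Fin 3) = 1 from rfl,
      add_zero, basePoint_self, basePoint_add_one, basePoint_add_two] at hp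
    exact hno ε (ρ * cubeRoot k) hε (by linear_combination 2 * ρ ^ 3 * hζ + hρ)
      (by linear_combination hp)

lemma X_cube_sum_eq_fermatCubic (j : Fin 3) {ε : ℂ} (hε : ε ^ 3 = 1) :
    X (j + 1) ^ 3 + (C ε * X (j + 2)) ^ 3 + X j ^ 3 = fermatCubic := by
  rw [mul_pow, ← map_pow, hε, map_one, one_mul, fermatCubic]
  fin_cases j <;> simp <;> ring

/-- The product of the three hyperosculating conics through a base point, up to a constant. -/
def conicTriple (j : Fin 3) (ε : ℂ) : MvPolynomial (Fin 3) ℂ :=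
  (X (j + 1) - C ε * X (j + 2)) ^ 6 - 16 * X j ^ 3 *
    (X (j + 1) ^ 3 + (C ε * X (j + 2)) ^ 3 + X j ^ 3)

/-- The three values are all the roots of 2ρ³ = -1, so the product of the A + Bρ + Cρ² is A³ - B³/2
+ C³/4 + 3ABC/2. With A = d², B = 2zs, C = -4z² this equals d⁶ - 16z³(x³ + y³ + z³), because s³ +
3sd² = 4(x³ + y³). -/
lemma osculatingConic_mul_eq_conicTriple (j : Fin 3) (ε : ℂ) {ρ₁ ρ₂ ρ₃ : ℂ}
    (h₁ : 2 * ρ₁ ^ 3 = -1) (h₂ : 2 * ρ₂ ^ 3 = -1) (h₃ : 2 * ρ₃ ^ 3 = -1)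
    (h₁₂ : ρ₁ ≠ ρ₂) (h₁₃ : ρ₁ ≠ ρ₃) (h₂₃ : ρ₂ ≠ ρ₃) :
    osculatingConic j ε ρ₁ * osculatingConic j ε ρ₂ * osculatingConic j ε ρ₃ =
      conicTriple j ε := by
  have hquad : ρ₁ ^ 2 + ρ₁ * ρ₂ + ρ₂ ^ 2 = 0 := by
    refine (mul_eq_zero.mp ?_).resolve_left (sub_ne_zero.mpr h₁₂)
    linear_combination (h₁ - h₂) / 2
  have hquad' : ρ₁ ^ 2 + ρ₁ * ρ₃ + ρ₃ ^ 2 = 0 := by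
    refine (mul_eq_zero.mp ?_).resolve_left (sub_ne_zero.mpr h₁₃)
    linear_combination (h₁ - h₃) / 2
  obtain rfl : ρ₃ = -ρ₁ - ρ₂ := by
    have : ρ₁ + ρ₂ + ρ₃ = 0 := by
      refine (mul_eq_zero.mp ?_).resolve_left (sub_ne_zero.mpr h₂₃)
      linear_combination hquad - hquad'
    linear_combination this
  have hC := congrArg (fun a : ℂ ↦ (C a : MvPolynomial (Fin 3) ℂ)) hquad
  have hC1 := congrArg (fun a : ℂ ↦ (C a : MvPolynomial (Fin 3) ℂ)) h₁
  simp only [osculatingConic, conicTriple, map_add, map_mul, map_pow, map_neg, map_sub, map_ofNat,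
    map_zero, map_one] at hC hC1 ⊢
  generalize (C ρ₁ : MvPolynomial (Fin 3) ℂ) = r at *
  generalize (C ρ₂ : MvPolynomial (Fin 3) ℂ) = s at *
  generalize (C ε * X (j + 2) : MvPolynomial (Fin 3) ℂ) = y at *
  generalize (X (j + 1) : MvPolynomial (Fin 3) ℂ) = x at *
  generalize (X j : MvPolynomial (Fin 3) ℂ) = z at *
  clear h₁ h₂ h₃ h₁₂ h₁₃ h₂₃ hquad hquad'
  grind

/-- The difference of two of the equations is a multiple of z(s - 2(ρ + ρ')z); comparing two such
differences gives z² = 0, and then d² = 0. -/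
theorem common_zero_osculatingConic_iff {j k : Fin 3} {ρ₁ ρ₂ ρ₃ : ℂ}
    (h₁₂ : ρ₁ ≠ ρ₂) (h₁₃ : ρ₁ ≠ ρ₃) (h₂₃ : ρ₂ ≠ ρ₃) (p : Fin 3 → ℂ) :
    (eval p (osculatingConic j (cubeRoot k)⁻¹ ρ₁) = 0 ∧
      eval p (osculatingConic j (cubeRoot k)⁻¹ ρ₂) = 0 ∧
      eval p (osculatingConic j (cubeRoot k)⁻¹ ρ₃) = 0) ↔ ∃ c : ℂ, p = c • basePoint j k := by
  have hζ := cubeRoot_ne_zero k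
  simp only [eval_osculatingConic]
  constructor
  · rintro ⟨e1, e2, e3⟩
    generalize hs : p (j + 1) + (cubeRoot k)⁻¹ * p (j + 2) = s at *
    have f12 : p j * s - 2 * (ρ₁ + ρ₂) * p j ^ 2 = 0 := by
      refine (mul_eq_zero.mp ?_).resolve_left (sub_ne_zero.mpr h₁₂)
      linear_combination (e1 - e2) / 2
    have f13 : p j * s - 2 * (ρ₁ + ρ₃) * p j ^ 2 = 0 := by
      refine (mul_eq_zero.mp ?_).resolve_left (sub_ne_zero.mpr h₁₃)
      linear_combination (e1 - e3) / 2
    have hz : p j = 0 := by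
      have : p j ^ 2 = 0 := by
        refine (mul_eq_zero.mp ?_).resolve_left (sub_ne_zero.mpr h₂₃)
        linear_combination (f13 - f12) / 2
      simpa using this
    rw [hz] at e1
    have hd : p (j + 1) - (cubeRoot k)⁻¹ * p (j + 2) = 0 := by
      have : (p (j + 1) - (cubeRoot k)⁻¹ * p (j + 2)) ^ 2 = 0 := by linear_combination e1
      simpa using this
    refine ⟨p (j + 1), funext (forall_fin_three_cyclic j ?_ ?_ ?_)⟩
    · simp [basePoint_self, hz]
    · simp [basePoint_add_one]
    · rw [Pi.smul_apply, basePoint_add_two, smul_eq_mul]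
      field_simp at hd
      linear_combination -hd
  · rintro ⟨c, rfl⟩
    simp [basePoint_self, basePoint_add_one, basePoint_add_two, hζ, mul_comm]

/-! ### The singularity at the base point -/

/-- The new coordinates are u = `X n` times a cube root of -16L and v = `X m`. The principal cube
root of L is analytic because L(0) is off the branch cut. -/
lemma germEquiv_of_eq {f H L : MvPolynomial (Fin 2) ℂ} {m n : Fin 2} (hmn : m ≠ n)
    (hH : eval 0 H ≠ 0) (hL : eval 0 L ∈ Complex.slitPlane)
    (hf : f = H * (X m ^ 6 - 16 * X n ^ 3 * L)) :
    GermEquiv (fun w ↦ eval w f) (fun w ↦ w 0 ^ 3 + 0 * w 0 ^ 2 * w 1 ^ 2 + w 1 ^ 6) := by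
  obtain ⟨κ, hκ⟩ := IsAlgClosed.exists_pow_nat_eq (-16 : ℂ) (n := 3) (by norm_num)
  have hκ0 : κ ≠ 0 := by
    rintro rfl
    norm_num at hκ
  let g : (Fin 2 → ℂ) → ℂ := fun w ↦ κ * eval w L ^ ((3 : ℕ) : ℂ)⁻¹
  have hg : AnalyticAt ℂ g 0 :=
    analyticAt_const.mul ((AnalyticOnNhd.eval_mvPolynomial L 0 trivial).cpow analyticAt_const hL)
  have hg0 : g 0 ≠ 0 := by
    refine mul_ne_zero hκ0 ?_
    rw [Ne, Complex.cpow_eq_zero_iff]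
    exact fun h ↦ Complex.slitPlane_ne_zero hL h.1
  have hpr : ∀ i : Fin 2, AnalyticAt ℂ (fun w : Fin 2 → ℂ ↦ w i) 0 := fun i ↦
    (ContinuousLinearMap.proj (R := ℂ) (φ := fun _ : Fin 2 ↦ ℂ) i).analyticAt 0
  refine ⟨fun w ↦ ![w n * g w, w m], fun w ↦ eval w H, ?_, ?_, ?_,
    AnalyticOnNhd.eval_mvPolynomial H 0 trivial, hH, ?_⟩
  · rw [analyticAt_pi_iff]
    intro i
    fin_cases i
    · exact (hpr n).mul hg
    · exact hpr m
  · funext i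
    fin_cases i <;> simp
  · have hd : HasFDerivAt (fun w : Fin 2 → ℂ ↦ (![w n * g w, w m] : Fin 2 → ℂ))
        (ContinuousLinearMap.pi ![g 0 • ContinuousLinearMap.proj (R := ℂ) n,
          ContinuousLinearMap.proj (R := ℂ) m]) 0 := by
      rw [hasFDerivAt_pi']
      intro i
      fin_cases i
      · have := (hasFDerivAt_apply (𝕜 := ℂ) (F' := fun _ : Fin 2 ↦ ℂ) n 0).mul
          hg.differentiableAt.hasFDerivAt
        refine this.congr_fderiv ?_
        ext w
        simp
      · exact hasFDerivAt_apply (𝕜 := ℂ) (F' := fun _ : Fin 2 ↦ ℂ) m 0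
    rw [hd.fderiv]
    have hinj : Function.Injective (ContinuousLinearMap.pi ![g 0 • ContinuousLinearMap.proj (R := ℂ)
        (φ := fun _ : Fin 2 ↦ ℂ) n, ContinuousLinearMap.proj (R := ℂ) m]).toLinearMap := by
      rw [← LinearMap.ker_eq_bot, LinearMap.ker_eq_bot']
      intro w hw
      have h0 : g 0 * w n = 0 := congrFun hw 0
      have h1 : w m = 0 := congrFun hw 1
      have h0 : w n = 0 := by simpa [hg0] using h0
      funext i
      rcases (show i = m ∨ i = n by lia) with rfl | rfl
      · exact h1
      · exact h0
    exact ⟨hinj, LinearMap.injective_iff_surjective.mp hinj⟩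
  · refine Filter.Eventually.of_forall fun w ↦ ?_
    have hc : g w ^ 3 = -16 * eval w L := by
      simp only [g]
      rw [mul_pow, hκ, Complex.cpow_nat_inv_pow _ (by norm_num)]
    simp only [hf, map_mul, map_sub, map_pow, eval_X, Matrix.cons_val_zero, Matrix.cons_val_one,
      map_ofNat]
    linear_combination (-(eval w H) * w n ^ 3) * hc

lemma localEq_zero_eq_aeval (p : Fin 3 → ℂ) (f : MvPolynomial (Fin 3) ℂ) :
    localEq p 0 f = aeval ![C (p 0), C (p 1) + X 0, C (p 2) + X 1] f := by
  have h := aeval_localEq_zero (X 0 : MvPolynomial (Fin 2) ℂ) (X 1) p f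
  rwa [show (![X 0, X 1] : Fin 2 → MvPolynomial (Fin 2) ℂ) = X by funext j; fin_cases j <;> rfl,
    aeval_X_left, AlgHom.id_apply] at h

lemma localEq_one_eq_aeval (p : Fin 3 → ℂ) (f : MvPolynomial (Fin 3) ℂ) :
    localEq p 1 f = aeval ![C (p 0) + X 0, C (p 1), C (p 2) + X 1] f := by
  have h := aeval_localEq_one (X 0 : MvPolynomial (Fin 2) ℂ) (X 1) p f
  rwa [show (![X 0, X 1] : Fin 2 → MvPolynomial (Fin 2) ℂ) = X by funext j; fin_cases j <;> rfl,
    aeval_X_left, AlgHom.id_apply] at h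

/-- Here L is the local equation of the cubic. The form d becomes an affine coordinate up to sign
and a power of ε, which the sixth power removes. -/
lemma exists_localEq_conicTriple (j k : Fin 3) :
    ∃ (m n : Fin 2) (L : MvPolynomial (Fin 2) ℂ), m ≠ n ∧ eval 0 L = 2 ∧
      localEq (basePoint j k) (chartIndex (basePoint j k)) (conicTriple j (cubeRoot k)⁻¹) =
        X m ^ 6 - 16 * X n ^ 3 * L := by
  have hζ0 := cubeRoot_ne_zero k
  have hζ3 := cubeRoot_pow_three k
  obtain ⟨ε, hε⟩ : ∃ ε, ε = (cubeRoot k)⁻¹ := ⟨_, rfl⟩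
  have hε1 : ε * cubeRoot k = 1 := by rw [hε]; field_simp
  have hε3 : ε ^ 3 = 1 := by rw [hε, inv_pow, hζ3, inv_one]
  have hC1 : (C ε * C (cubeRoot k) : MvPolynomial (Fin 2) ℂ) = 1 := by rw [← C_mul, hε1, C_1]
  have hC3 : (C ε ^ 3 : MvPolynomial (Fin 2) ℂ) = 1 := by rw [← C_pow, hε3, C_1]
  rw [conicTriple, ← hε, X_cube_sum_eq_fermatCubic j hε3]
  have h1 := basePoint_self j k
  have h2 := basePoint_add_one j k
  have h3 := basePoint_add_two j k
  generalize basePoint j k = p at *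
  fin_cases j
  · replace h1 : p 0 = 0 := h1
    replace h2 : p 1 = 1 := h2
    replace h3 : p 2 = cubeRoot k := h3
    rw [show chartIndex p = 1 by simp [chartIndex, h1, h2]]
    refine ⟨1, 0, localEq p 1 fermatCubic, by decide, ?_, ?_⟩
    · rw [localEq_one_eq_aeval]
      simp [fermatCubic, h1, h2, h3, hζ3]
      norm_num
    · simp only [localEq_one_eq_aeval]
      simp only [map_sub, map_mul, map_pow, map_ofNat]
      simp [h1, h2, h3]
      rw [show (1 - C ε * (C (cubeRoot k) + X 1) : MvPolynomial (Fin 2) ℂ) = -(C ε * X 1) by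
        linear_combination -hC1]
      linear_combination (C ε ^ 3 + 1) * X 1 ^ 6 * hC3
  · replace h1 : p 1 = 0 := h1
    replace h2 : p 2 = 1 := h2
    replace h3 : p 0 = cubeRoot k := h3
    rw [show chartIndex p = 0 by simp [chartIndex, h3, hζ0]]
    refine ⟨1, 0, localEq p 0 fermatCubic, by decide, ?_, ?_⟩
    · rw [localEq_zero_eq_aeval]
      simp [fermatCubic, h1, h2, h3, hζ3]
      norm_num
    · simp only [localEq_zero_eq_aeval]
      simp only [map_sub, map_mul, map_pow, map_ofNat]
      simp [h1, h2, h3]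
      rw [hC1]
      ring
  · replace h1 : p 2 = 0 := h1
    replace h2 : p 0 = 1 := h2
    replace h3 : p 1 = cubeRoot k := h3
    rw [show chartIndex p = 0 by simp [chartIndex, h2]]
    refine ⟨0, 1, localEq p 0 fermatCubic, by decide, ?_, ?_⟩
    · rw [localEq_zero_eq_aeval]
      simp [fermatCubic, h1, h2, h3, hζ3]
      norm_num
    · simp only [localEq_zero_eq_aeval]
      simp only [map_sub, map_mul, map_pow, map_ofNat]
      simp [h1, h2, h3]
      rw [show (1 - C ε * (C (cubeRoot k) + X 0) : MvPolynomial (Fin 2) ℂ) = -(C ε * X 0) by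
        linear_combination -hC1]
      linear_combination (C ε ^ 3 + 1) * X 0 ^ 6 * hC3

lemma eval_zero_localEq (p : Fin 3 → ℂ) (i : Fin 3) (f : MvPolynomial (Fin 3) ℂ) :
    eval 0 (localEq p i f) = eval p f := by
  rw [localEq, ← MvPolynomial.aeval_eq_eval, ← MvPolynomial.aeval_eq_eval]
  change ((aeval 0).comp (aeval _)) f = aeval p f
  rw [comp_aeval]
  congr 2
  funext l
  induction l using Fin.succAboveCases i <;> simp

theorem hasJ20Singularity_of_eq {j k : Fin 3} {f H : MvPolynomial (Fin 3) ℂ}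
    (hH : eval (basePoint j k) H ≠ 0) (hf : f = H * conicTriple j (cubeRoot k)⁻¹) :
    HasJ20Singularity f (basePoint j k) := by
  obtain ⟨m, n, L, hmn, hL, h⟩ := exists_localEq_conicTriple j k
  refine ⟨0, by norm_num, germEquiv_of_eq
    (H := localEq (basePoint j k) (chartIndex (basePoint j k)) H) hmn ?_ (L := L) ?_ ?_⟩
  · rwa [eval_zero_localEq]
  · rw [hL]; simp [Complex.slitPlane]
  · rw [← h, hf, localEq, map_mul]; rfl

/-! ### The nonic has no factor in common with all its partial derivatives -/

lemma sum_fin_three_cyclic {M : Type*} [AddCommMonoid M] (g : Fin 3 → M) (j : Fin 3) :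
    ∑ i, g i = g (j + 1) + g (j + 2) + g j := by
  rw [Fin.sum_univ_three]
  fin_cases j
  · change _ = g 1 + g 2 + g 0
    abel
  · change _ = g 2 + g 0 + g 1
    abel
  · rfl

lemma irreducible_X_add_C_mul_X {σ K : Type*} [Field K] {a b : σ} (hab : a ≠ b) (c : K) :
    Irreducible (X a + C c * X b : MvPolynomial σ K) := by
  classical
  have hcoef : coeff (Finsupp.single a 1) (X a + C c * X b : MvPolynomial σ K) = 1 := by
    rw [coeff_add, coeff_C_mul, coeff_X, coeff_X]
    simp [Finsupp.single_left_inj, hab.symm]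
  apply irreducible_of_totalDegree_eq_one
  · apply le_antisymm
    · refine (totalDegree_add _ _).trans (max_le (totalDegree_X a).le ?_)
      refine (totalDegree_mul _ _).trans ?_
      rw [totalDegree_C, totalDegree_X]
    · have := le_totalDegree (s := Finsupp.single a 1) (mem_support_iff.mpr (by
        rw [hcoef]; exact one_ne_zero))
      simpa using this
  · intro x hx
    exact isUnit_of_dvd_one (hcoef ▸ hx (Finsupp.single a 1))

lemma eval_eq_zero_of_irreducible_dvd {σ K : Type*} [Field K] {π l h : MvPolynomial σ K}
    (hπ : Irreducible π) (hl : Irreducible l) (hπl : π ∣ l) (hπh : π ∣ h) {p : σ → K}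
    (hp : eval p l = 0) : eval p h = 0 := by
  obtain ⟨w, rfl⟩ := (hπ.dvd_symm hl hπl).trans hπh
  rw [map_mul, hp, zero_mul]

/-- The point with coordinates `x_{j+1} = x`, `x_{j+2} = y`, `x_j = z`. -/
def cyclicPoint (j : Fin 3) (x y z : ℂ) : Fin 3 → ℂ :=
  fun i ↦ if i = j then z else if i = j + 1 then x else y

@[simp] lemma cyclicPoint_self (j : Fin 3) (x y z : ℂ) : cyclicPoint j x y z j = z := by
  simp [cyclicPoint]

@[simp] lemma cyclicPoint_add_one (j : Fin 3) (x y z : ℂ) : cyclicPoint j x y z (j + 1) = x := by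
  simp [cyclicPoint]

@[simp] lemma cyclicPoint_add_two (j : Fin 3) (x y z : ℂ) : cyclicPoint j x y z (j + 2) = y := by
  simp [cyclicPoint]

/-- No irreducible polynomial in `x = x_{j+1}`, `y = ε x_{j+2}`, `z = x_j` divides the product of
`F = x³ + y³ + z³` and `G = (x - y)⁶ - 16 z³ F` together with its partial derivatives. -/
lemma not_dvd_partials (j : Fin 3) {ε : ℂ} (hε : ε ≠ 0) {x y z F G π : MvPolynomial (Fin 3) ℂ}
    (hx : x = X (j + 1)) (hy : y = C ε * X (j + 2)) (hz : z = X j)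
    (hF : F = x ^ 3 + y ^ 3 + z ^ 3) (hG : G = (x - y) ^ 6 - 16 * z ^ 3 * F)
    (hπ : Irreducible π) (h : π ∣ F * G)
    (h₁ : π ∣ 3 * x ^ 2 * G + F * (6 * (x - y) ^ 5 - 48 * z ^ 3 * x ^ 2))
    (h₂ : π ∣ 3 * y ^ 2 * G + F * (-6 * (x - y) ^ 5 - 48 * z ^ 3 * y ^ 2))
    (h₃ : π ∣ 3 * z ^ 2 * G + F * (-48 * z ^ 2 * F - 48 * z ^ 5)) : False := by
  have hp : Prime π := hπ.prime
  have hunit : ∀ n : ℕ, n ≠ 0 → ¬ π ∣ (n : MvPolynomial (Fin 3) ℂ) := by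
    intro n hn hd
    refine hπ.not_isUnit (isUnit_of_dvd_unit hd ?_)
    rw [← map_natCast (C : ℂ →+* MvPolynomial (Fin 3) ℂ)]
    exact (isUnit_iff_ne_zero.mpr (Nat.cast_ne_zero.mpr hn)).map C
  have hlin : ∀ c : ℂ, Irreducible (x + C c * y) := by
    intro c
    rw [hx, hy, ← mul_assoc, ← C_mul]
    exact irreducible_X_add_C_mul_X (by simp) _
  have hlz : Irreducible z := hz ▸ X_prime.irreducible
  have hevx : ∀ a b c, eval (cyclicPoint j a (ε⁻¹ * b) c) x = a := by simp [hx]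
  have hevy : ∀ a b c, eval (cyclicPoint j a (ε⁻¹ * b) c) y = b := by simp [hy, hε]
  have hevz : ∀ a b c, eval (cyclicPoint j a (ε⁻¹ * b) c) z = c := by simp [hz]
  have hdz : π ∣ z → π ∣ x - y → False := by
    intro h1 h2
    have := eval_eq_zero_of_irreducible_dvd hπ hlz h1 h2 (hevz 1 0 0)
    simp only [map_sub, hevx, hevy] at this
    norm_num at this
  have hxz : π ∣ z → π ∣ x → False := by
    intro h1 h2
    have := eval_eq_zero_of_irreducible_dvd hπ hlz h1 h2 (hevz 1 0 0)
    simp only [hevx, one_ne_zero] at this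
  have hdF : π ∣ x - y → π ∣ F → False := by
    intro h1 h2
    have hl : x - y = x + C (-1) * y := by simp; ring
    rw [hl] at h1
    have := eval_eq_zero_of_irreducible_dvd hπ (hlin (-1)) h1 h2
      (p := cyclicPoint j 1 (ε⁻¹ * 1) 0) (by simp only [map_add, map_mul, eval_C, hevx, hevy]; ring)
    simp only [hF, map_add, map_pow, hevx, hevy, hevz] at this
    norm_num at this
  by_cases hπF : π ∣ F
  · by_cases hπG : π ∣ G
    · have : π ∣ (x - y) ^ 6 := by
        rw [hG] at hπG
        exact (dvd_sub_left (hπF.mul_left _)).mp hπG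
      exact hdF (hp.dvd_of_dvd_pow this) hπF
    · rw [dvd_add_left (hπF.mul_right _)] at h₁ h₃
      have key : ∀ w : MvPolynomial (Fin 3) ℂ, π ∣ 3 * w ^ 2 * G → π ∣ w := by
        intro w hw
        have := ((hp.dvd_or_dvd hw).resolve_right hπG)
        exact hp.dvd_of_dvd_pow ((hp.dvd_or_dvd this).resolve_left
          (by exact_mod_cast hunit 3 (by norm_num)))
      exact hxz (key z h₃) (key x h₁)
  · have hπG : π ∣ G := (hp.dvd_or_dvd h).resolve_left hπF
    rw [dvd_add_right (hπG.mul_left _)] at h₁ h₂ h₃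
    replace h₁ := (hp.dvd_or_dvd h₁).resolve_left hπF
    replace h₂ := (hp.dvd_or_dvd h₂).resolve_left hπF
    replace h₃ := (hp.dvd_or_dvd h₃).resolve_left hπF
    have h48 : ¬ π ∣ 48 := by exact_mod_cast hunit 48 (by norm_num)
    have hzπ : ¬ π ∣ z := by
      intro hd
      rw [hG, dvd_sub_left (((hd.pow three_ne_zero).mul_left _).mul_right _)] at hπG
      exact hdz hd (hp.dvd_of_dvd_pow hπG)
    -- In the sum of the x- and y-derivatives of G the terms in (x - y)⁵ cancel.
    have hs : π ∣ x ^ 2 + y ^ 2 := by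
      have : π ∣ 48 * (z ^ 3 * (x ^ 2 + y ^ 2)) := by
        have := (dvd_add h₁ h₂).neg_right
        refine this.trans (dvd_of_eq (by ring))
      exact (hp.dvd_or_dvd ((hp.dvd_or_dvd this).resolve_left h48)).resolve_left
        fun hd ↦ hzπ (hp.dvd_of_dvd_pow hd)
    have ht : π ∣ F + z ^ 3 := by
      have : π ∣ 48 * (z ^ 2 * (F + z ^ 3)) := h₃.neg_right.trans (dvd_of_eq (by ring))
      exact (hp.dvd_or_dvd ((hp.dvd_or_dvd this).resolve_left h48)).resolve_left
        fun hd ↦ hzπ (hp.dvd_of_dvd_pow hd)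
    -- On the plane x + cy = 0 the form F + z³ = x³ + y³ + 2z³ still varies with z, so it does not
    -- vanish there identically.
    have hlinear : ∀ c : ℂ, ¬ π ∣ x + C c * y := by
      intro c hd
      have e0 := eval_eq_zero_of_irreducible_dvd hπ (hlin c) hd ht
        (p := cyclicPoint j (-c) (ε⁻¹ * 1) 0)
        (by simp only [map_add, map_mul, eval_C, hevx, hevy]; ring)
      have e1 := eval_eq_zero_of_irreducible_dvd hπ (hlin c) hd ht
        (p := cyclicPoint j (-c) (ε⁻¹ * 1) 1)
        (by simp only [map_add, map_mul, eval_C, hevx, hevy]; ring)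
      simp only [hF, map_add, map_pow, hevx, hevy, hevz] at e0 e1
      have : (2 : ℂ) = 0 := by linear_combination e1 - e0
      norm_num at this
    have hfac : x ^ 2 + y ^ 2 = (x + C Complex.I * y) * (x + C (-Complex.I) * y) := by
      have hI : (C Complex.I * C Complex.I : MvPolynomial (Fin 3) ℂ) = -1 := by
        rw [← C_mul, Complex.I_mul_I, C_neg, C_1]
      rw [C_neg]
      linear_combination y ^ 2 * hI
    rw [hfac] at hs
    rcases hp.dvd_or_dvd hs with hs | hs
    · exact hlinear _ hs
    · exact hlinear _ hs

/-- The product of the Fermat cubic and `conicTriple j ε`. -/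
def nonic (j : Fin 3) (ε : ℂ) : MvPolynomial (Fin 3) ℂ :=
  (X (j + 1) ^ 3 + (C ε * X (j + 2)) ^ 3 + X j ^ 3) * conicTriple j ε

section Partials

variable {j : Fin 3} {ε : ℂ} {x y z F G : MvPolynomial (Fin 3) ℂ}

lemma nonic_eq (hx : x = X (j + 1)) (hy : y = C ε * X (j + 2)) (hz : z = X j)
    (hF : F = x ^ 3 + y ^ 3 + z ^ 3) (hG : G = (x - y) ^ 6 - 16 * z ^ 3 * F) :
    nonic j ε = F * G := by
  rw [nonic, conicTriple, hG, hF, hx, hy, hz]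

lemma pderiv_nonic_add_one (hx : x = X (j + 1)) (hy : y = C ε * X (j + 2)) (hz : z = X j)
    (hF : F = x ^ 3 + y ^ 3 + z ^ 3) (hG : G = (x - y) ^ 6 - 16 * z ^ 3 * F) :
    pderiv (j + 1) (nonic j ε) =
      3 * x ^ 2 * G + F * (6 * (x - y) ^ 5 - 48 * z ^ 3 * x ^ 2) := by
  have h1 : pderiv (j + 1) x = 1 := by rw [hx, pderiv_X_self]
  have h2 : pderiv (j + 1) y = 0 := by
    rw [hy, pderiv_C_mul, pderiv_X_of_ne (by simp), mul_zero]
  have h3 : pderiv (j + 1) z = 0 := by rw [hz, pderiv_X_of_ne (by simp)]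
  have h16 : pderiv (j + 1) (16 : MvPolynomial (Fin 3) ℂ) = 0 := by
    rw [← map_ofNat C 16, pderiv_C]
  rw [nonic_eq hx hy hz hF hG]
  simp only [hG, hF, Derivation.leibniz, Derivation.leibniz_pow, map_add, map_sub, h1, h2, h3, h16,
    smul_eq_mul, nsmul_eq_mul]
  push_cast
  ring

lemma pderiv_nonic_add_two (hx : x = X (j + 1)) (hy : y = C ε * X (j + 2)) (hz : z = X j)
    (hF : F = x ^ 3 + y ^ 3 + z ^ 3) (hG : G = (x - y) ^ 6 - 16 * z ^ 3 * F) :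
    pderiv (j + 2) (nonic j ε) =
      C ε * (3 * y ^ 2 * G + F * (-6 * (x - y) ^ 5 - 48 * z ^ 3 * y ^ 2)) := by
  have h1 : pderiv (j + 2) x = 0 := by rw [hx, pderiv_X_of_ne (by simp)]
  have h2 : pderiv (j + 2) y = C ε := by rw [hy, pderiv_C_mul, pderiv_X_self, mul_one]
  have h3 : pderiv (j + 2) z = 0 := by rw [hz, pderiv_X_of_ne (by simp)]
  have h16 : pderiv (j + 2) (16 : MvPolynomial (Fin 3) ℂ) = 0 := by
    rw [← map_ofNat C 16, pderiv_C]
  rw [nonic_eq hx hy hz hF hG]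
  simp only [hG, hF, Derivation.leibniz, Derivation.leibniz_pow, map_add, map_sub, h1, h2, h3, h16,
    smul_eq_mul, nsmul_eq_mul]
  push_cast
  ring

lemma pderiv_nonic_self (hx : x = X (j + 1)) (hy : y = C ε * X (j + 2)) (hz : z = X j)
    (hF : F = x ^ 3 + y ^ 3 + z ^ 3) (hG : G = (x - y) ^ 6 - 16 * z ^ 3 * F) :
    pderiv j (nonic j ε) = 3 * z ^ 2 * G + F * (-48 * z ^ 2 * F - 48 * z ^ 5) := by
  have h1 : pderiv j x = 0 := by rw [hx, pderiv_X_of_ne (by simp)]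
  have h2 : pderiv j y = 0 := by rw [hy, pderiv_C_mul, pderiv_X_of_ne (by simp), mul_zero]
  have h3 : pderiv j z = 1 := by rw [hz, pderiv_X_self]
  have h16 : pderiv j (16 : MvPolynomial (Fin 3) ℂ) = 0 := by
    rw [← map_ofNat C 16, pderiv_C]
  rw [nonic_eq hx hy hz hF hG]
  simp only [hG, hF, Derivation.leibniz, Derivation.leibniz_pow, map_add, map_sub, h1, h2, h3, h16,
    smul_eq_mul, nsmul_eq_mul]
  push_cast
  ring

end Partials

lemma not_dvd_pderiv_nonic (j : Fin 3) {ε : ℂ} (hε : ε ≠ 0) {π : MvPolynomial (Fin 3) ℂ}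
    (hπ : Irreducible π) (h : π ∣ nonic j ε) (h' : ∀ i, π ∣ pderiv i (nonic j ε)) : False := by
  have h1 := h' (j + 1)
  have h2 := h' (j + 2)
  have h3 := h' j
  rw [pderiv_nonic_add_one rfl rfl rfl rfl rfl] at h1
  rw [pderiv_nonic_add_two rfl rfl rfl rfl rfl] at h2
  rw [pderiv_nonic_self rfl rfl rfl rfl rfl] at h3
  rw [nonic_eq rfl rfl rfl rfl rfl] at h
  refine not_dvd_partials j hε rfl rfl rfl rfl rfl hπ h h1 ?_ h3
  exact (((isUnit_iff_ne_zero.mpr hε).map C).dvd_mul_left).mp h2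

lemma nonic_ne_zero (j : Fin 3) (ε : ℂ) : nonic j ε ≠ 0 := by
  intro h
  have := congrArg (eval (cyclicPoint j 1 0 0)) h
  simp [nonic, conicTriple] at this

lemma squarefree_nonic (j : Fin 3) {ε : ℂ} (hε : ε ≠ 0) : Squarefree (nonic j ε) := by
  rw [squarefree_iff_no_irreducibles (nonic_ne_zero j ε)]
  rintro π hπ ⟨w, hw⟩
  refine not_dvd_pderiv_nonic j hε hπ (hw ▸ ⟨π * w, by ring⟩) fun i ↦ ?_
  rw [hw]
  simp only [Derivation.leibniz, smul_eq_mul]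
  exact ⟨π * pderiv i w + 2 * w * pderiv i π, by ring⟩

/-- Once the common factor with D is removed, what remains of the nonic divides all its partial
derivatives, hence is a unit. -/
lemma nonic_dvd_of_dvd_mul_pderiv (j : Fin 3) {ε : ℂ} (hε : ε ≠ 0) {D : MvPolynomial (Fin 3) ℂ}
    (h : ∀ i, nonic j ε ∣ D * pderiv i (nonic j ε)) : nonic j ε ∣ D := by
  have h0 := nonic_ne_zero j ε
  obtain ⟨a, b, c, hab, ha, hb⟩ := UniqueFactorizationMonoid.exists_reduced_factors _ h0 D
  have hc : c ≠ 0 := by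
    rintro rfl
    exact h0 (by rw [← ha, zero_mul])
  have hd : ∀ i, a ∣ pderiv i (nonic j ε) := by
    intro i
    have := h i
    rw [← hb, mul_assoc] at this
    nth_rewrite 1 [← ha] at this
    exact hab.dvd_of_dvd_mul_left ((mul_dvd_mul_iff_left hc).mp this)
  have hu : IsUnit a := by
    by_contra hu
    have ha0 : a ≠ 0 := by
      rintro rfl
      exact h0 (by rw [← ha, mul_zero])
    obtain ⟨π, hπ, hπa⟩ := WfDvdMonoid.exists_irreducible_factor hu ha0
    exact not_dvd_pderiv_nonic j hε hπ (hπa.trans (ha ▸ dvd_mul_left a c))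
      fun i ↦ hπa.trans (hd i)
  rw [← ha, ← hb, hu.mul_right_dvd]
  exact dvd_mul_right c b

/-! ### Two explicit syzygies and Saito's criterion -/

/-- The triple with components `a, ε⁻¹ b, c` at `j + 1, j + 2, j`: the vector field
`a ∂_x + b ∂_y + c ∂_z` in the coordinates `x = x_{j+1}`, `y = ε x_{j+2}`, `z = x_j`. -/
def cyclicField (j : Fin 3) (ε : ℂ) (a b c : MvPolynomial (Fin 3) ℂ) :
    Fin 3 → MvPolynomial (Fin 3) ℂ :=
  fun i ↦ if i = j then c else if i = j + 1 then a else C ε⁻¹ * b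

section

variable (j : Fin 3) (ε : ℂ) (a b c : MvPolynomial (Fin 3) ℂ)

@[simp] lemma cyclicField_self : cyclicField j ε a b c j = c := by simp [cyclicField]

@[simp] lemma cyclicField_add_one : cyclicField j ε a b c (j + 1) = a := by simp [cyclicField]

@[simp] lemma cyclicField_add_two : cyclicField j ε a b c (j + 2) = C ε⁻¹ * b := by
  simp [cyclicField]

end

lemma mem_jacobianSyzygies {f : MvPolynomial (Fin 3) ℂ} {r : Fin 3 → MvPolynomial (Fin 3) ℂ} :
    r ∈ jacobianSyzygies f ↔ ∑ i, r i * pderiv i f = 0 := Iff.rfl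

/-- The Jacobian syzygy of degree `3` of `nonic j ε`. -/
def cubicSyzygy (j : Fin 3) (ε : ℂ) : Fin 3 → MvPolynomial (Fin 3) ℂ :=
  let x := X (j + 1)
  let y := C ε * X (j + 2)
  let z := X j
  -- The nonic is symmetric in x and y, that is, under d ↦ -d. This field is invariant under the
  -- exchange, and the quintic one changes sign.
  let s := x + y
  let d := x - y
  cyclicField j ε
    (-2 * s ^ 3 - 8 * s * d ^ 2 - 24 * z ^ 3 + d * (s ^ 2 + d ^ 2))
    (-2 * s ^ 3 - 8 * s * d ^ 2 - 24 * z ^ 3 - d * (s ^ 2 + d ^ 2))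
    (8 * z * (s ^ 2 + d ^ 2))

/-- The Jacobian syzygy of degree `5` of `nonic j ε`. -/
def quinticSyzygy (j : Fin 3) (ε : ℂ) : Fin 3 → MvPolynomial (Fin 3) ℂ :=
  let x := X (j + 1)
  let y := C ε * X (j + 2)
  let z := X j
  let s := x + y
  let d := x - y
  cyclicField j ε
    (8 * s ^ 2 * d * z ^ 2 + 12 * d ^ 3 * z ^ 2 -
      6 * s ^ 3 * z ^ 2 - 16 * s * d ^ 2 * z ^ 2 - 24 * z ^ 5)
    (8 * s ^ 2 * d * z ^ 2 + 12 * d ^ 3 * z ^ 2 +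
      6 * s ^ 3 * z ^ 2 + 16 * s * d ^ 2 * z ^ 2 + 24 * z ^ 5)
    (16 * s * d * z ^ 3 - 6 * d ^ 5)

lemma isHomogeneous_monomial_of_linear {σ R : Type*} [CommSemiring R] {s d z : MvPolynomial σ R}
    (hs : s.IsHomogeneous 1) (hd : d.IsHomogeneous 1) (hz : z.IsHomogeneous 1) (c : R)
    {n : ℕ} (i j k : ℕ) (hn : i + j + k = n) :
    (C c * (s ^ i * d ^ j * z ^ k)).IsHomogeneous n := by
  subst hn
  simpa using (isHomogeneous_C σ c).mul (((hs.pow i).mul (hd.pow j)).mul (hz.pow k))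

section Homogeneous

variable (j : Fin 3) (ε : ℂ)

lemma isHomogeneous_cubicSyzygy (i : Fin 3) : (cubicSyzygy j ε i).IsHomogeneous 3 := by
  have hs := (isHomogeneous_X ℂ (j + 1)).add (isHomogeneous_C_mul_X ε (j + 2))
  have hd := (isHomogeneous_X ℂ (j + 1)).sub (isHomogeneous_C_mul_X ε (j + 2))
  have h := isHomogeneous_monomial_of_linear (n := 3) hs hd (isHomogeneous_X ℂ j)
  rw [cubicSyzygy]
  generalize (X (j + 1) + C ε * X (j + 2) : MvPolynomial (Fin 3) ℂ) = s at *
  generalize (X (j + 1) - C ε * X (j + 2) : MvPolynomial (Fin 3) ℂ) = d at *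
  generalize (X j : MvPolynomial (Fin 3) ℂ) = z at *
  revert i
  refine forall_fin_three_cyclic j ?_ ?_ ?_
  · have := (h 8 2 0 1 rfl).add (h 8 0 2 1 rfl)
    rw [cyclicField_self]
    refine (congrArg (fun f : MvPolynomial (Fin 3) ℂ ↦ f.IsHomogeneous 3) ?_).mpr this
    simp only [map_ofNat]
    ring
  · have := (((h (-2) 3 0 0 rfl).add (h (-8) 1 2 0 rfl)).add (h (-24) 0 0 3 rfl)).add
      ((h 1 2 1 0 rfl).add (h 1 0 3 0 rfl))
    rw [cyclicField_add_one]
    refine (congrArg (fun f : MvPolynomial (Fin 3) ℂ ↦ f.IsHomogeneous 3) ?_).mpr this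
    simp only [map_ofNat, map_neg, map_one]
    ring
  · have := (((h (-2) 3 0 0 rfl).add (h (-8) 1 2 0 rfl)).add (h (-24) 0 0 3 rfl)).sub
      ((h 1 2 1 0 rfl).add (h 1 0 3 0 rfl))
    rw [cyclicField_add_two]
    refine IsHomogeneous.C_mul ?_ _
    refine (congrArg (fun f : MvPolynomial (Fin 3) ℂ ↦ f.IsHomogeneous 3) ?_).mpr this
    simp only [map_ofNat, map_neg, map_one]
    ring

lemma isHomogeneous_quinticSyzygy (i : Fin 3) : (quinticSyzygy j ε i).IsHomogeneous 5 := by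
  have hs := (isHomogeneous_X ℂ (j + 1)).add (isHomogeneous_C_mul_X ε (j + 2))
  have hd := (isHomogeneous_X ℂ (j + 1)).sub (isHomogeneous_C_mul_X ε (j + 2))
  have h := isHomogeneous_monomial_of_linear (n := 5) hs hd (isHomogeneous_X ℂ j)
  rw [quinticSyzygy]
  generalize (X (j + 1) + C ε * X (j + 2) : MvPolynomial (Fin 3) ℂ) = s at *
  generalize (X (j + 1) - C ε * X (j + 2) : MvPolynomial (Fin 3) ℂ) = d at *
  generalize (X j : MvPolynomial (Fin 3) ℂ) = z at *
  revert i
  refine forall_fin_three_cyclic j ?_ ?_ ?_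
  · have := (h 16 1 1 3 rfl).add (h (-6) 0 5 0 rfl)
    rw [cyclicField_self]
    refine (congrArg (fun f : MvPolynomial (Fin 3) ℂ ↦ f.IsHomogeneous 5) ?_).mpr this
    simp only [map_ofNat, map_neg]
    ring
  · have := ((h 8 2 1 2 rfl).add (h 12 0 3 2 rfl)).sub
      (((h 6 3 0 2 rfl).add (h 16 1 2 2 rfl)).add (h 24 0 0 5 rfl))
    rw [cyclicField_add_one]
    refine (congrArg (fun f : MvPolynomial (Fin 3) ℂ ↦ f.IsHomogeneous 5) ?_).mpr this
    simp only [map_ofNat]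
    ring
  · have := ((h 8 2 1 2 rfl).add (h 12 0 3 2 rfl)).add
      (((h 6 3 0 2 rfl).add (h 16 1 2 2 rfl)).add (h 24 0 0 5 rfl))
    rw [cyclicField_add_two]
    refine IsHomogeneous.C_mul ?_ _
    refine (congrArg (fun f : MvPolynomial (Fin 3) ℂ ↦ f.IsHomogeneous 5) ?_).mpr this
    simp only [map_ofNat]
    ring

end Homogeneous

section Cross

variable {K : Type*} [CommRing K]

/-- If two vectors are orthogonal to `g`, their triple product with `e` times `g` is the
multiple `e · g` of their cross product. -/
lemma triple_product_mul {e₁ e₂ e₃ u₁ u₂ u₃ v₁ v₂ v₃ g₁ g₂ g₃ f : K}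
    (he : e₁ * g₁ + e₂ * g₂ + e₃ * g₃ = f) (hu : u₁ * g₁ + u₂ * g₂ + u₃ * g₃ = 0)
    (hv : v₁ * g₁ + v₂ * g₂ + v₃ * g₃ = 0) {D : K}
    (hD : D = e₁ * (u₂ * v₃ - u₃ * v₂) + e₂ * (u₃ * v₁ - u₁ * v₃) + e₃ * (u₁ * v₂ - u₂ * v₁)) :
    f ∣ D * g₁ ∧ f ∣ D * g₂ ∧ f ∣ D * g₃ := by
  refine ⟨⟨u₂ * v₃ - u₃ * v₂, ?_⟩, ⟨u₃ * v₁ - u₁ * v₃, ?_⟩, ⟨u₁ * v₂ - u₂ * v₁, ?_⟩⟩ <;>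
    rw [hD, ← he]
  · linear_combination (v₂ * e₃ - v₃ * e₂) * hu + (e₂ * u₃ - e₃ * u₂) * hv
  · linear_combination (v₃ * e₁ - v₁ * e₃) * hu + (e₃ * u₁ - e₁ * u₃) * hv
  · linear_combination (v₁ * e₂ - v₂ * e₁) * hu + (e₁ * u₂ - e₂ * u₁) * hv

end Cross

/-- The data for Saito's criterion: the Euler relation, and the two syzygies as factors of 8∇f in a
cross product. Orthogonality of a cross product to its factors already shows that both fields are
syzygies. -/
lemma exists_gradient_nonic (j : Fin 3) (ε : ℂ) :
    ∃ g₁ g₂ g₃ : MvPolynomial (Fin 3) ℂ,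
      pderiv (j + 1) (nonic j ε) = g₁ ∧ pderiv (j + 2) (nonic j ε) = C ε * g₂ ∧
      pderiv j (nonic j ε) = g₃ ∧
      X (j + 1) * g₁ + C ε * X (j + 2) * g₂ + X j * g₃ = 9 * nonic j ε ∧
      ∃ a₁ a₂ a₃ b₁ b₂ b₃ : MvPolynomial (Fin 3) ℂ,
        cubicSyzygy j ε = cyclicField j ε a₁ a₂ a₃ ∧
        quinticSyzygy j ε = cyclicField j ε b₁ b₂ b₃ ∧
        a₂ * b₃ - a₃ * b₂ = 8 * g₁ ∧ a₃ * b₁ - a₁ * b₃ = 8 * g₂ ∧ a₁ * b₂ - a₂ * b₁ = 8 * g₃ := by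
  refine ⟨_, _, _, pderiv_nonic_add_one rfl rfl rfl rfl rfl,
    pderiv_nonic_add_two rfl rfl rfl rfl rfl, pderiv_nonic_self rfl rfl rfl rfl rfl, ?_,
    _, _, _, _, _, _, rfl, rfl, ?_, ?_, ?_⟩
  · rw [nonic_eq rfl rfl rfl rfl rfl]
    ring
  · ring
  · ring
  · ring

lemma cyclicField_mem_jacobianSyzygies_nonic {j : Fin 3} {ε : ℂ} (hε : ε ≠ 0)
    {g₁ g₂ g₃ : MvPolynomial (Fin 3) ℂ} (h₁ : pderiv (j + 1) (nonic j ε) = g₁)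
    (h₂ : pderiv (j + 2) (nonic j ε) = C ε * g₂) (h₃ : pderiv j (nonic j ε) = g₃)
    (a b c : MvPolynomial (Fin 3) ℂ) :
    cyclicField j ε a b c ∈ jacobianSyzygies (nonic j ε) ↔ a * g₁ + b * g₂ + c * g₃ = 0 := by
  have hC : (C ε⁻¹ * C ε : MvPolynomial (Fin 3) ℂ) = 1 := by
    rw [← C_mul, inv_mul_cancel₀ hε, C_1]
  rw [mem_jacobianSyzygies, sum_fin_three_cyclic _ j, h₁, h₂, h₃, cyclicField_self,
    cyclicField_add_one, cyclicField_add_two]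
  rw [show C ε⁻¹ * b * (C ε * g₂) = b * g₂ by linear_combination (b * g₂) * hC]

lemma exists_eq_cyclicField (j : Fin 3) {ε : ℂ} (hε : ε ≠ 0)
    (r : Fin 3 → MvPolynomial (Fin 3) ℂ) : ∃ a b c, r = cyclicField j ε a b c := by
  refine ⟨r (j + 1), C ε * r (j + 2), r j, funext (forall_fin_three_cyclic j ?_ ?_ ?_)⟩
  · rw [cyclicField_self]
  · rw [cyclicField_add_one]
  · rw [cyclicField_add_two, ← mul_assoc, ← C_mul, inv_mul_cancel₀ hε, C_1, one_mul]

lemma smul_cyclicField_add (j : Fin 3) (ε : ℂ) (u v a b c a' b' c' : MvPolynomial (Fin 3) ℂ) :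
    u • cyclicField j ε a b c + v • cyclicField j ε a' b' c' =
      cyclicField j ε (u * a + v * a') (u * b + v * b') (u * c + v * c') := by
  refine funext (forall_fin_three_cyclic j ?_ ?_ ?_) <;>
    simp only [Pi.add_apply, Pi.smul_apply, smul_eq_mul, cyclicField_self, cyclicField_add_one,
      cyclicField_add_two]
  ring

lemma span_syzygies_eq_jacobianSyzygies_nonic (j : Fin 3) {ε : ℂ} (hε : ε ≠ 0) :
    Submodule.span (MvPolynomial (Fin 3) ℂ) {cubicSyzygy j ε, quinticSyzygy j ε} =
      jacobianSyzygies (nonic j ε) := by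
  obtain ⟨g₁, g₂, g₃, h₁, h₂, h₃, hE, a₁, a₂, a₃, b₁, b₂, b₃, ha, hb, c₁, c₂, c₃⟩ :=
    exists_gradient_nonic j ε
  have h8 : (8 : MvPolynomial (Fin 3) ℂ) ≠ 0 := by norm_num
  have hag : a₁ * g₁ + a₂ * g₂ + a₃ * g₃ = 0 := by
    refine (mul_eq_zero.mp ?_).resolve_left h8
    linear_combination -a₁ * c₁ - a₂ * c₂ - a₃ * c₃
  have hbg : b₁ * g₁ + b₂ * g₂ + b₃ * g₃ = 0 := by
    refine (mul_eq_zero.mp ?_).resolve_left h8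
    linear_combination -b₁ * c₁ - b₂ * c₂ - b₃ * c₃
  rw [ha, hb]
  apply le_antisymm
  · rw [Submodule.span_le]
    rintro r (rfl | rfl)
    · exact (cyclicField_mem_jacobianSyzygies_nonic hε h₁ h₂ h₃ _ _ _).mpr hag
    · exact (cyclicField_mem_jacobianSyzygies_nonic hε h₁ h₂ h₃ _ _ _).mpr hbg
  · intro r hr
    obtain ⟨r₁, r₂, r₃, rfl⟩ := exists_eq_cyclicField j hε r
    rw [cyclicField_mem_jacobianSyzygies_nonic hε h₁ h₂ h₃] at hr
    have hf0 := nonic_ne_zero j ε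
    have hdvd : ∀ D, (9 * nonic j ε ∣ D * g₁ ∧ 9 * nonic j ε ∣ D * g₂ ∧ 9 * nonic j ε ∣ D * g₃) →
        nonic j ε ∣ D := by
      rintro D ⟨d₁, d₂, d₃⟩
      apply nonic_dvd_of_dvd_mul_pderiv j hε
      refine forall_fin_three_cyclic j ?_ ?_ ?_
      · rw [h₃]; exact (dvd_mul_left _ _).trans d₃
      · rw [h₁]; exact (dvd_mul_left _ _).trans d₁
      · rw [h₂, mul_left_comm]; exact ((dvd_mul_left _ _).trans d₂).mul_left _
    -- With E the Euler field and a, b the two syzygies, u and v are the Cramer numerators det(E, r,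
    -- b) and det(E, a, r) divided by f.
    obtain ⟨u, hu⟩ := hdvd _ (triple_product_mul hE hr hbg rfl)
    obtain ⟨v, hv⟩ := hdvd _ (triple_product_mul hE hag hr rfl)
    rw [Submodule.mem_span_pair]
    have h72 : (C (1 / 72) * 72 : MvPolynomial (Fin 3) ℂ) = 1 := by
      rw [← map_ofNat C 72, ← C_mul, ← C_1]
      norm_num
    refine ⟨C (1 / 72) * u, C (1 / 72) * v, ?_⟩
    rw [smul_cyclicField_add]
    generalize (X (j + 1) : MvPolynomial (Fin 3) ℂ) = x at *
    generalize (C ε * X (j + 2) : MvPolynomial (Fin 3) ℂ) = y at *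
    generalize (X j : MvPolynomial (Fin 3) ℂ) = z at *
    generalize (C (1 / 72) : MvPolynomial (Fin 3) ℂ) = κ at *
    generalize nonic j ε = f at *
    -- Cramer's rule with determinant 72f = 8 · 9f. The coefficient of E is r · (a × b) = 8 r · ∇f =
    -- 0.
    congr 1 <;> apply mul_left_cancel₀ hf0
    · linear_combination -κ * a₁ * hu - κ * b₁ * hv + f * r₁ * h72 +
        κ * (r₁ * (x * c₁ + y * c₂ + z * c₃) - x * (r₁ * c₁ + r₂ * c₂ + r₃ * c₃) +
          8 * r₁ * hE - 8 * x * hr)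
    · linear_combination -κ * a₂ * hu - κ * b₂ * hv + f * r₂ * h72 +
        κ * (r₂ * (x * c₁ + y * c₂ + z * c₃) - y * (r₁ * c₁ + r₂ * c₂ + r₃ * c₃) +
          8 * r₂ * hE - 8 * y * hr)
    · linear_combination -κ * a₃ * hu - κ * b₃ * hv + f * r₃ * h72 +
        κ * (r₃ * (x * c₁ + y * c₂ + z * c₃) - z * (r₁ * c₁ + r₂ * c₂ + r₃ * c₃) +
          8 * r₃ * hE - 8 * z * hr)

/-- Proportional syzygies would have zero cross product, so ∇f = 0 and, by Euler, f = 0. -/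
lemma syzygy_not_mem_span_singleton {j : Fin 3} {ε : ℂ} (hε : ε ≠ 0)
    {r r' : Fin 3 → MvPolynomial (Fin 3) ℂ}
    (h : (r = cubicSyzygy j ε ∧ r' = quinticSyzygy j ε) ∨
      (r = quinticSyzygy j ε ∧ r' = cubicSyzygy j ε)) :
    r ∉ Submodule.span (MvPolynomial (Fin 3) ℂ) {r'} := by
  obtain ⟨g₁, g₂, g₃, -, -, -, hE, a₁, a₂, a₃, b₁, b₂, b₃, ha, hb, c₁, c₂, c₃⟩ :=
    exists_gradient_nonic j ε
  have hCε : (C ε⁻¹ : MvPolynomial (Fin 3) ℂ) ≠ 0 := by simpa using hε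
  have key : (a₂ * b₃ - a₃ * b₂ = 0 ∧ a₃ * b₁ - a₁ * b₃ = 0 ∧ a₁ * b₂ - a₂ * b₁ = 0) → False := by
    rintro ⟨e₁, e₂, e₃⟩
    apply nonic_ne_zero j ε
    refine (mul_eq_zero.mp ?_).resolve_left (show (72 : MvPolynomial (Fin 3) ℂ) ≠ 0 by norm_num)
    linear_combination X (j + 1) * (e₁ - c₁) + C ε * X (j + 2) * (e₂ - c₂) + X j * (e₃ - c₃) -
      8 * hE
  intro hmem
  obtain ⟨w, hw⟩ := Submodule.mem_span_singleton.mp hmem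
  have w₁ := congrFun hw (j + 1)
  have w₂ := congrFun hw (j + 2)
  have w₃ := congrFun hw j
  apply key
  rcases h with ⟨rfl, rfl⟩ | ⟨rfl, rfl⟩ <;>
    simp only [ha, hb, Pi.smul_apply, smul_eq_mul, cyclicField_self, cyclicField_add_one,
      cyclicField_add_two, mul_left_comm w, mul_right_inj' hCε] at w₁ w₂ w₃ <;>
    rw [← w₁, ← w₂, ← w₃] <;> refine ⟨?_, ?_, ?_⟩ <;> ring

theorem isFreeCurve_nonic (j : Fin 3) {ε : ℂ} (hε : ε ≠ 0) : IsFreeCurve (nonic j ε) 3 5 := by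
  refine ⟨squarefree_nonic j hε, ?_, ?_, ![cubicSyzygy j ε, quinticSyzygy j ε], ?_, ?_, ?_⟩
  · intro a b hab
    fin_cases a <;> fin_cases b <;> simp at hab ⊢
  · intro l
    fin_cases l <;> simp
  · intro l
    fin_cases l
    · exact isHomogeneous_cubicSyzygy j ε
    · exact isHomogeneous_quinticSyzygy j ε
  · rw [← span_syzygies_eq_jacobianSyzygies_nonic j hε]
    congr 1
    ext r
    simp [or_comm]
  · intro l
    fin_cases l
    · have : ({0}ᶜ : Set (Fin 2)) = {1} := by ext i; fin_cases i <;> simp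
      simp only [Fin.zero_eta, this, Set.image_singleton]
      exact syzygy_not_mem_span_singleton hε (Or.inl ⟨rfl, rfl⟩)
    · have : ({1}ᶜ : Set (Fin 2)) = {0} := by ext i; fin_cases i <;> simp
      simp only [Fin.mk_one, this, Set.image_singleton]
      exact syzygy_not_mem_span_singleton hε (Or.inr ⟨rfl, rfl⟩)

lemma IsFreeCurve.C_mul {f : MvPolynomial (Fin 3) ℂ} {d₁ d₂ : ℕ} (hf : IsFreeCurve f d₁ d₂) {κ : ℂ}
    (hκ : κ ≠ 0) : IsFreeCurve (C κ * f) d₁ d₂ := by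
  have hu : IsUnit (C κ : MvPolynomial (Fin 3) ℂ) := (isUnit_iff_ne_zero.mpr hκ).map C
  have hs : jacobianSyzygies (C κ * f) = jacobianSyzygies f := by
    ext r
    simp only [mem_jacobianSyzygies, pderiv_C_mul, mul_left_comm _ (C κ), ← Finset.mul_sum,
      mul_eq_zero, hu.ne_zero, false_or]
  obtain ⟨h₁, h₂, h₃, r, h₄, h₅, h₆⟩ := hf
  exact ⟨(associated_unit_mul_left f _ hu).squarefree_iff.mpr h₁, h₂, h₃, r, h₄, h₅.trans hs.symm,
    h₆⟩

end

/-! ### The theorem -/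

theorem theorem4p8 (j k : Fin 3) (Q Q' Q'' : MvPolynomial (Fin 3) ℂ)
    (hQ : Q ∈ conicClass j k) (hQ' : Q' ∈ conicClass j k) (hQ'' : Q'' ∈ conicClass j k)
    (h₁ : ¬ Associated Q Q') (h₂ : ¬ Associated Q Q'') (h₃ : ¬ Associated Q' Q'') :
    (∀ p : Fin 3 → ℂ, p ≠ 0 →
      ((eval p Q = 0 ∧ eval p Q' = 0 ∧ eval p Q'' = 0) ↔ ∃ c : ℂ, p = c • basePoint j k)) ∧
    HasJ20Singularity (Q * Q' * Q'') (basePoint j k) ∧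
    HasJ20Singularity (fermatCubic * Q * Q' * Q'') (basePoint j k) ∧
    (fermatCubic * Q * Q' * Q'').IsHomogeneous 9 ∧
    IsFreeCurve (fermatCubic * Q * Q' * Q'') 3 5 := by
  have hhom : (fermatCubic * Q * Q' * Q'').IsHomogeneous 9 := by
    have hF : fermatCubic.IsHomogeneous 3 :=
      ((isHomogeneous_X_pow 0 3).add (isHomogeneous_X_pow 1 3)).add (isHomogeneous_X_pow 2 3)
    exact ((hF.mul hQ.1.2.1).mul hQ'.1.2.1).mul hQ''.1.2.1
  -- Conics with the same ρ differ by a constant, so non-associated ones have distinct parameters.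
  have hne : ∀ {ρ ρ' c c' : ℂ}, c ≠ 0 → c' ≠ 0 →
      ¬ Associated (C c * osculatingConic j (cubeRoot k)⁻¹ ρ)
        (C c' * osculatingConic j (cubeRoot k)⁻¹ ρ') → ρ ≠ ρ' := by
    rintro ρ _ c c' hc hc' h rfl
    have hu : ∀ {c : ℂ}, c ≠ 0 → IsUnit (C c : MvPolynomial (Fin 3) ℂ) := fun hc ↦
      (isUnit_iff_ne_zero.mpr hc).map C
    exact h ((associated_unit_mul_left _ _ (hu hc)).trans
      (associated_unit_mul_left _ _ (hu hc')).symm)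
  obtain ⟨ρ₁, c₁, hρ₁, hc₁, rfl⟩ := exists_eq_of_mem_conicClass hQ
  obtain ⟨ρ₂, c₂, hρ₂, hc₂, rfl⟩ := exists_eq_of_mem_conicClass hQ'
  obtain ⟨ρ₃, c₃, hρ₃, hc₃, rfl⟩ := exists_eq_of_mem_conicClass hQ''
  have h₁₂ := hne hc₁ hc₂ h₁
  have h₁₃ := hne hc₁ hc₃ h₂
  have h₂₃ := hne hc₂ hc₃ h₃
  have hε : (cubeRoot k)⁻¹ ≠ 0 := inv_ne_zero (cubeRoot_ne_zero k)
  have hprod := osculatingConic_mul_eq_conicTriple j (cubeRoot k)⁻¹ hρ₁ hρ₂ hρ₃ h₁₂ h₁₃ h₂₃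
  have hκ : c₁ * c₂ * c₃ ≠ 0 := mul_ne_zero (mul_ne_zero hc₁ hc₂) hc₃
  have hFp : eval (basePoint j k) fermatCubic ≠ 0 := by
    rw [← X_cube_sum_eq_fermatCubic j (one_pow 3)]
    simp only [map_add, map_mul, map_pow, eval_X, eval_C, basePoint_self, basePoint_add_one,
      basePoint_add_two, one_mul, cubeRoot_pow_three]
    norm_num
  refine ⟨fun p _ ↦ ?_, ?_, ?_, hhom, ?_⟩
  · simp only [map_mul, eval_C, mul_eq_zero, hc₁, hc₂, hc₃, false_or]
    exact common_zero_osculatingConic_iff h₁₂ h₁₃ h₂₃ p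
  · refine hasJ20Singularity_of_eq (H := C (c₁ * c₂ * c₃)) (by simpa using hκ) ?_
    rw [← hprod, C_mul, C_mul]
    ring
  · refine hasJ20Singularity_of_eq (H := C (c₁ * c₂ * c₃) * fermatCubic) ?_ ?_
    · rw [map_mul, eval_C]
      exact mul_ne_zero hκ hFp
    · rw [← hprod, C_mul, C_mul]
      ring
  · have h := (isFreeCurve_nonic j hε).C_mul hκ
    rw [nonic, X_cube_sum_eq_fermatCubic j (by rw [inv_pow, cubeRoot_pow_three, inv_one]),
      ← hprod, C_mul, C_mul] at h
    convert h using 1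
    ring
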